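/- Fix a real number $h>1$, let $\Omega=\mathbb C\setminus\{s:\operatorname{Re}s\ge 0,\ |\operatorname{Im}s|=\sqrt{h-1}\}$ and $f(s)=\zeta(s^2+h)$ for $s\in\Omega$, with $\zeta$ the Riemann zeta function. Definitions. An entire function $\phi$ is of exponential type if $|\phi(z)|\le Ce^{\tau|z|}$ for some $C,\tau$ and all $z$; its type $\tau_\phi$ is the infimum of the $\tau>0$ for which such a $C>0$ exists. Its Borel transform is $\mathcal B(\phi)(z)=\sum_{n\ge0}\phi^{(n)}(0)z^{-n-1}$ for $|z|>\tau_\phi$. $Exp(\Omega)$ is the space of entire functions $\phi$ of exponential type whose Borel transform extends to an analytic function, still written $\mathcal B(\phi)$, on a connected open set $U_\phi\supseteq\{|z|>\tau_\phi\}\cup(\mathbb C\setminus\Omega)$; such an extension is understood to be chosen with $\phi$. $H_1(\phi)$ is the set of positively oriented simple closed rectifiable curves $\gamma\subset\Omega$ whose bounded region contains $s(\mathcal B(\phi))=\mathbb C\setminus U_\phi$, and on such a curve $d\mu_\phi(s)=\mathcal B(\phi)(s)\,\frac{ds}{2\pi i}$. A function $\phi\in Exp(\Omega)$ is a solution of $\zeta(\partial_t^2+h)\phi=g$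 if $\int_{\gamma}e^{ts}f(s)\,d\mu_\phi(s)=g(t)$ for all $t\in\mathbb C$, with $\gamma\in H_1(\phi)$ (the integral does not depend on the choice of the extension and of $\gamma$). Theorem. Let $g,\phi\in Exp(\Omega)$, and let $Z_\phi=\{s\in\Omega: f(s)=0,\ |s|\le\tau_\phi\}$. Then $Z_\phi$ is finite. Let $\gamma\in H_1(g)$ be a curve that passes through no zero of $f$ and such that the zeros of $f$ in its bounded region are exactly the points of $Z_\phi$. Then $\phi$ is a solution of $\zeta(\partial_t^2+h)\phi=g$ if and only if there are polynomials $p_k$, one for each $s_k\in Z_\phi$, of degree less than the multiplicity of the zero $s_k$ of $f$, such that for all $t\in\mathbb C$ $$\phi(t)=\int_\gamma\frac{e^{ts}}{\zeta(s^2+h)}\,d\mu_g(s)+\sum_{s_k\in Z_\phi}p_k(t)e^{ts_k}.$$ If $\phi$ is a solution, then such a curve $\gamma$ exists. Moreover, for every $\gamma\in H_1(g)$ that passes through no zero of $f$, whichever zeros it encloses, this formula implies that $\phi$ is a solution. -/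

import Mathlib

/-- `φ` is an entire function of (finite) exponential type. -/
def IsExpTypeEntire (φ : ℂ → ℂ) : Prop :=
  Differentiable ℂ φ ∧ ∃ C τ : ℝ, ∀ z : ℂ, ‖φ z‖ ≤ C * Real.exp (τ * ‖z‖)

/-- The exponential type `τ_φ`: the infimum of the `τ > 0` such that `|φ(z)| ≤ C e^{τ|z|}` for all
`z` and some `C > 0`. -/
noncomputable def expType (φ : ℂ → ℂ) : ℝ :=
  sInf {τ : ℝ | 0 < τ ∧ ∃ C : ℝ, 0 < C ∧ ∀ z : ℂ, ‖φ z‖ ≤ C * Real.exp (τ * ‖z‖)}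

/-- The Borel transform `∑ a_n n! / z^{n+1}` of `φ(z) = ∑ a_n z^n` (so `a_n n! = φ^{(n)}(0)`);
the series converges for `|z| > τ_φ`. -/
noncomputable def borelSeries (φ : ℂ → ℂ) (z : ℂ) : ℂ :=
  ∑' n : ℕ, iteratedDeriv n φ 0 / z ^ (n + 1)

/-- `B`, considered on the domain `U`, is an analytic continuation of the Borel transform of `φ`
(given by its series on `|z| > τ_φ`) to a neighbourhood of the complement of `Ω`.
The point `∞` of the extended plane needs no condition of its own, because `U` contains
`|z| > τ_φ` and the series vanishes at `∞`. The singular set `s(B)` of the pair is `Uᶜ`; it is a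
compact subset of `Ω` and is contained in `|z| ≤ τ_φ`. -/
structure IsBorelTransform (Ω : Set ℂ) (φ B : ℂ → ℂ) (U : Set ℂ) : Prop where
  isOpen : IsOpen U
  isPreconnected : IsPreconnected U
  compl_subset : Ωᶜ ⊆ U
  subset_of_lt : {z : ℂ | expType φ < ‖z‖} ⊆ U
  differentiableOn : DifferentiableOn ℂ B U
  eq_series : ∀ z : ℂ, expType φ < ‖z‖ → B z = borelSeries φ z

/-- The space `Exp(Ω)`. -/
def ExpSpace (Ω : Set ℂ) : Set (ℂ → ℂ) :=
  {φ | IsExpTypeEntire φ ∧ ∃ (B : ℂ → ℂ) (U : Set ℂ), IsBorelTransform Ω φ B U}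

/-- The integral `∫_γ F(s) ds` along a curve parametrised by `[0, 1]`. -/
noncomputable def curveInt (γ : ℝ → ℂ) (F : ℂ → ℂ) : ℂ :=
  ∫ t in (0 : ℝ)..1, F (γ t) * deriv γ t

/-- The trace of a curve parametrised by `[0, 1]`. -/
def curveTrace (γ : ℝ → ℂ) : Set ℂ := γ '' Set.Icc 0 1

/-- The bounded region of a closed curve: the points off the curve that lie in a bounded component
of the complement of the curve. -/
def curveInside (γ : ℝ → ℂ) : Set ℂ :=
  {z | z ∉ curveTrace γ ∧ Bornology.IsBounded (connectedComponentIn (curveTrace γ)ᶜ z)}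

/-- Positively oriented simple closed rectifiable curves. A rectifiable curve is given by a
Lipschitz parametrisation (for instance a multiple of arc length), so that `deriv γ` exists almost
everywhere and is bounded. Positive orientation means that the curve winds once, counterclockwise,
around every point of its bounded region. -/
structure IsSimpleClosedCurve (γ : ℝ → ℂ) : Prop where
  lipschitz : ∃ K : NNReal, LipschitzOnWith K γ (Set.Icc 0 1)
  closed : γ 0 = γ 1
  simple : Set.InjOn γ (Set.Ico 0 1)
  positive : ∀ z ∈ curveInside γ, curveInt γ (fun s => (s - z)⁻¹) = 2 * Real.pi * Complex.I

/-- The curves of `H₁(φ)` that are contained in `Ω`, where `U` is the domain of the Borel transform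
of `φ`: the simple closed rectifiable curves in `Ω` with the singular set `Uᶜ` in their bounded
region. They all wind once around `Uᶜ`, so they are pairwise homologous in `U`. -/
def HOne (Ω U : Set ℂ) : Set (ℝ → ℂ) :=
  {γ | IsSimpleClosedCurve γ ∧ curveTrace γ ⊆ Ω ∧ Uᶜ ⊆ curveInside γ}

/-- `𝒫(k μ)(t) = ∫ e^{ts} k(s) dμ(s)` for the complex measure `dμ(s) = B(s) ds / (2πi)` on the
curve `γ`. -/
noncomputable def pTransform (γ : ℝ → ℂ) (k B : ℂ → ℂ) (t : ℂ) : ℂ :=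
  (2 * Real.pi * Complex.I)⁻¹ * curveInt γ (fun s => Complex.exp (t * s) * k s * B s)

/-- `φ` solves `f(∂_t) φ = g`, that is `𝒫(f μ_φ) = g`, where `dμ_φ = B(φ)(s) ds / (2πi)` on a curve
`γ ∈ H₁(φ)` in `Ω`. For holomorphic `f` and simply connected `Ω` the left side does not depend on
the choice of the curve. -/
def SolvesSymbolEquation (Ω : Set ℂ) (f φ g : ℂ → ℂ) : Prop :=
  ∃ (B : ℂ → ℂ) (U : Set ℂ) (γ : ℝ → ℂ),
    IsBorelTransform Ω φ B U ∧ γ ∈ HOne Ω U ∧ ∀ t : ℂ, pTransform γ f B t = g t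

/-- The zeros of `f` in `Ω`. -/
def zeroSet (Ω : Set ℂ) (f : ℂ → ℂ) : Set ℂ := {s | s ∈ Ω ∧ f s = 0}

/-- The plane without the two half-lines `Re s ≥ 0`, `|Im s| = √(h - 1)`. -/
noncomputable def zetaDomain (h : ℝ) : Set ℂ :=
  {s : ℂ | ¬ (0 ≤ s.re ∧ |s.im| = Real.sqrt (h - 1))}

/-- The symbol `s ↦ ζ(s² + h)`. -/
noncomputable def zetaSymbol (h : ℝ) (s : ℂ) : ℂ := riemannZeta (s ^ 2 + (h : ℂ))

/-- `φ(t) = ∫_γ e^{ts} / f(s) dμ_g(s) + ∑ p_k(t) e^{t s_k}` for some polynomials `p_k` of degree less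
than the multiplicity of `s_k`, where `dμ_g(s) = Bg(s) ds / (2πi)` on `γ` and the `s_k` are the
zeros of `f` in `Ω` with `|s_k| ≤ τ_φ`. -/
def HasRepresentation (Ω : Set ℂ) (f φ Bg : ℂ → ℂ) (γ : ℝ → ℂ) : Prop :=
  ∃ p : ℂ → Polynomial ℂ,
    (∀ s ∈ zeroSet Ω f ∩ Metric.closedBall 0 (expType φ),
      (p s).degree < (analyticOrderNatAt f s : WithBot ℕ)) ∧
    ∀ t : ℂ, φ t = pTransform γ (fun s => (f s)⁻¹) Bg t +
      ∑ᶠ s ∈ zeroSet Ω f ∩ Metric.closedBall 0 (expType φ), (p s).eval t * Complex.exp (t * s)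

/-! Write `f` for the symbol, `B` and `Bg` for the Borel transforms of `φ` and `g`, and let `Γ`
enclose the singular sets of both. By Pólya's formula (`IsBorelTransform.curveInt_exp`), `φ` is a
solution exactly when `f B - Bg` has vanishing exponential transform on `Γ`. Differentiating in `t`
at `0` shows that all its moments vanish, hence its Cauchy integral vanishes outside `Γ`, hence it
agrees on `Γ` with a function `E` holomorphic inside (`exists_extension_of_curveInt_exp_eq_zero`).
So the whole problem is about `f B = Bg + E` on `Γ`.

For a solution, `B = Bg / f + E / f`. The poles of `E / f` inside `Γ` are zeros of `f`, of order at
most the multiplicity, and the principal part at `a` is the Borel transform of some `p(t) e^{at}`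
with `deg p` below the multiplicity. Integrating against `e^{ts}` gives the formula. Conversely, the
formula says that `B` minus the matching combination of `Bg / f` and principal parts is annihilated,
hence extends inside; after multiplication by `f` the principal parts become holomorphic and only
`Bg` contributes. A zero enclosed by `Γ` but not by `γ` adds one more principal part, which `f`
cancels in the same way. That is why `γ` may enclose any zeros in this direction.

In the other direction the zeros inside `γ` must be those with `|s| ≤ τ_φ`. A solution satisfies
`τ_g ≤ τ_φ` (`expType_le_of_solves`), so the singular set of `Bg` lies in that disc and a suitable
curve exists.

The Jordan curve theorem is not needed. Winding number one inside is part of positive orientation,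
winding number zero outside follows from the vanishing of the moments of `1`, Cauchy's theorem is
proved in Dixon's way, and the enclosing curves are explicit: circles dented to avoid the two
half-lines. -/

open MeasureTheory Set Filter Topology

/-! ### Integrals along closed Lipschitz curves -/

/-- A closed rectifiable curve, given by a Lipschitz parametrisation on `[0, 1]`. -/
structure IsLipschitzLoop (γ : ℝ → ℂ) : Prop where
  lipschitz : ∃ K : NNReal, LipschitzOnWith K γ (Icc 0 1)
  closed : γ 0 = γ 1

lemma IsSimpleClosedCurve.isLipschitzLoop {γ : ℝ → ℂ} (h : IsSimpleClosedCurve γ) :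
    IsLipschitzLoop γ := ⟨h.lipschitz, h.closed⟩

lemma mem_curveTrace {γ : ℝ → ℂ} {t : ℝ} (ht : t ∈ Icc (0 : ℝ) 1) : γ t ∈ curveTrace γ :=
  mem_image_of_mem γ ht

namespace IsLipschitzLoop

variable {γ : ℝ → ℂ}

lemma continuousOn (h : IsLipschitzLoop γ) : ContinuousOn γ (Icc 0 1) :=
  h.lipschitz.choose_spec.continuousOn

lemma isCompact_curveTrace (h : IsLipschitzLoop γ) : IsCompact (curveTrace γ) :=
  isCompact_Icc.image_of_continuousOn h.continuousOn

lemma isOpen_compl_curveTrace (h : IsLipschitzLoop γ) : IsOpen (curveTrace γ)ᶜ :=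
  h.isCompact_curveTrace.isClosed.isOpen_compl

lemma exists_norm_deriv_le (h : IsLipschitzLoop γ) :
    ∃ L : ℝ, 0 ≤ L ∧ ∀ t ∈ Ioo (0 : ℝ) 1, ‖deriv γ t‖ ≤ L := by
  obtain ⟨K, hK⟩ := h.lipschitz
  exact ⟨K, K.2, fun t ht => norm_deriv_le_of_lipschitzOn (Icc_mem_nhds ht.1 ht.2) hK⟩

lemma ae_uIoc {p : ℝ → Prop} (hp : ∀ᵐ t : ℝ, t ∈ Ioo (0 : ℝ) 1 → p t) :
    ∀ᵐ t : ℝ, t ∈ uIoc (0 : ℝ) 1 → p t := by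
  have h1 : ∀ᵐ t : ℝ, t ≠ 1 := by simp [ae_iff, measure_singleton]
  filter_upwards [hp, h1] with t ht ht1 h
  rw [uIoc_of_le zero_le_one] at h
  exact ht ⟨h.1, lt_of_le_of_ne h.2 ht1⟩

lemma ae_restrict_uIoc {p : ℝ → Prop} (hp : ∀ᵐ t : ℝ, t ∈ Ioo (0 : ℝ) 1 → p t) :
    ∀ᵐ t ∂(volume.restrict (uIoc (0 : ℝ) 1)), p t :=
  (ae_restrict_iff' measurableSet_uIoc).2 (ae_uIoc hp)

lemma ae_hasDerivAt (h : IsLipschitzLoop γ) :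
    ∀ᵐ t : ℝ, t ∈ Ioo (0 : ℝ) 1 → HasDerivAt γ (deriv γ t) t := by
  obtain ⟨K, hK⟩ := h.lipschitz
  filter_upwards [hK.ae_differentiableWithinAt_of_mem_real] with t ht h1
  exact ((ht (Ioo_subset_Icc_self h1)).differentiableAt (Icc_mem_nhds h1.1 h1.2)).hasDerivAt

lemma aestronglyMeasurable (h : IsLipschitzLoop γ) {F : ℂ → ℂ}
    (hF : ContinuousOn F (curveTrace γ)) :
    AEStronglyMeasurable (fun t => F (γ t) * deriv γ t) (volume.restrict (uIoc (0 : ℝ) 1)) := by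
  refine AEStronglyMeasurable.mul ?_ (measurable_deriv γ).aestronglyMeasurable
  have : ContinuousOn (fun t => F (γ t)) (Icc 0 1) :=
    hF.comp h.continuousOn fun t ht => mem_curveTrace ht
  rw [uIoc_of_le zero_le_one]
  exact (this.mono Ioc_subset_Icc_self).aestronglyMeasurable measurableSet_Ioc

lemma intervalIntegrable (h : IsLipschitzLoop γ) {F : ℂ → ℂ}
    (hF : ContinuousOn F (curveTrace γ)) :
    IntervalIntegrable (fun t => F (γ t) * deriv γ t) volume 0 1 := by
  obtain ⟨L, hL0, hL⟩ := h.exists_norm_deriv_le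
  obtain ⟨M, hM⟩ := h.isCompact_curveTrace.exists_bound_of_continuousOn hF
  rw [intervalIntegrable_iff]
  have : IsFiniteMeasure (volume.restrict (uIoc (0 : ℝ) 1)) := ⟨by simp⟩
  refine Integrable.of_bound (h.aestronglyMeasurable hF) (M * L) ?_
  refine ae_restrict_uIoc (ae_of_all _ fun t ht => ?_)
  rw [norm_mul]
  have := hM (γ t) (mem_curveTrace (Ioo_subset_Icc_self ht))
  exact mul_le_mul this (hL t ht) (norm_nonneg _) ((norm_nonneg _).trans this)

lemma exists_norm_curveInt_le (h : IsLipschitzLoop γ) :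
    ∃ L : ℝ, 0 ≤ L ∧ ∀ (F : ℂ → ℂ) (M : ℝ), 0 ≤ M → (∀ s ∈ curveTrace γ, ‖F s‖ ≤ M) →
      ‖curveInt γ F‖ ≤ L * M := by
  obtain ⟨L, hL0, hL⟩ := h.exists_norm_deriv_le
  refine ⟨L, hL0, fun F M hM0 hM => ?_⟩
  have := intervalIntegral.norm_integral_le_of_norm_le_const_ae (a := 0) (b := 1)
    (C := M * L) (f := fun t => F (γ t) * deriv γ t) (ae_uIoc (ae_of_all _ fun t ht => by
      rw [norm_mul]
      exact mul_le_mul (hM _ (mem_curveTrace (Ioo_subset_Icc_self ht))) (hL t ht)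
        (norm_nonneg _) hM0))
  simpa [curveInt, mul_comm] using this

lemma curveInt_add (h : IsLipschitzLoop γ) {F G : ℂ → ℂ} (hF : ContinuousOn F (curveTrace γ))
    (hG : ContinuousOn G (curveTrace γ)) :
    curveInt γ (fun s => F s + G s) = curveInt γ F + curveInt γ G := by
  simp only [curveInt, add_mul]
  exact intervalIntegral.integral_add (h.intervalIntegrable hF) (h.intervalIntegrable hG)

lemma curveInt_sub (h : IsLipschitzLoop γ) {F G : ℂ → ℂ} (hF : ContinuousOn F (curveTrace γ))
    (hG : ContinuousOn G (curveTrace γ)) :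
    curveInt γ (fun s => F s - G s) = curveInt γ F - curveInt γ G := by
  simp only [curveInt, sub_mul]
  exact intervalIntegral.integral_sub (h.intervalIntegrable hF) (h.intervalIntegrable hG)

end IsLipschitzLoop

lemma curveInt_const_mul (γ : ℝ → ℂ) (c : ℂ) (F : ℂ → ℂ) :
    curveInt γ (fun s => c * F s) = c * curveInt γ F := by
  simp only [curveInt, mul_assoc]
  exact intervalIntegral.integral_const_mul c _

lemma curveInt_congr {γ : ℝ → ℂ} {F G : ℂ → ℂ} (h : ∀ s ∈ curveTrace γ, F s = G s) :
    curveInt γ F = curveInt γ G := by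
  refine intervalIntegral.integral_congr fun t ht => ?_
  rw [uIcc_of_le zero_le_one] at ht
  simp only [h _ (mem_curveTrace ht)]

@[simp] lemma curveInt_zero (γ : ℝ → ℂ) : curveInt γ (fun _ => 0) = 0 := by
  simp [curveInt]

lemma IsLipschitzLoop.curveInt_finset_sum {γ : ℝ → ℂ} (h : IsLipschitzLoop γ) {ι : Type*}
    (S : Finset ι) {F : ι → ℂ → ℂ} (hF : ∀ i ∈ S, ContinuousOn (F i) (curveTrace γ)) :
    curveInt γ (fun s => ∑ i ∈ S, F i s) = ∑ i ∈ S, curveInt γ (F i) := by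
  simp only [curveInt, Finset.sum_mul]
  exact intervalIntegral.integral_finsetSum fun i hi => h.intervalIntegrable (hF i hi)

/-- The fundamental theorem of calculus for complex valued Lipschitz functions. -/
lemma LipschitzOnWith.integral_deriv_eq_sub_complex {u : ℝ → ℂ} {K : NNReal} {a b : ℝ}
    (hab : a ≤ b) (hu : LipschitzOnWith K u (Icc a b)) : ∫ t in a..b, deriv u t = u b - u a := by
  have hd : ∀ᵐ t : ℝ, t ∈ uIoc a b → HasDerivAt u (deriv u t) t := by
    have h1 : ∀ᵐ t : ℝ, t ≠ b := by simp [ae_iff, measure_singleton]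
    filter_upwards [hu.ae_differentiableWithinAt_of_mem_real, h1] with t ht h1 h2
    rw [uIoc_of_le hab] at h2
    exact ((ht ⟨h2.1.le, h2.2⟩).differentiableAt
      (Icc_mem_nhds h2.1 (lt_of_le_of_ne h2.2 h1))).hasDerivAt
  have hbd : ∀ᵐ t : ℝ, t ∈ uIoc a b → ‖deriv u t‖ ≤ K := by
    have h1 : ∀ᵐ t : ℝ, t ≠ b := by simp [ae_iff, measure_singleton]
    filter_upwards [h1] with t h1 h2
    rw [uIoc_of_le hab] at h2
    exact norm_deriv_le_of_lipschitzOn (Icc_mem_nhds h2.1 (lt_of_le_of_ne h2.2 h1)) hu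
  have hint : IntervalIntegrable (deriv u) volume a b := by
    rw [intervalIntegrable_iff]
    refine Measure.integrableOn_of_bounded (M := K) (by simp)
      (measurable_deriv u).aestronglyMeasurable ?_
    exact (ae_restrict_iff' measurableSet_uIoc).2 hbd
  -- The fundamental theorem for real absolutely continuous functions is applied to the real and
  -- imaginary parts.
  have key : ∀ (T : ℂ →L[ℝ] ℝ), T (∫ t in a..b, deriv u t) = T (u b) - T (u a) := by
    intro T
    have hT : LipschitzOnWith (‖T‖₊ * K) (fun t => T (u t)) (uIcc a b) := by
      rw [uIcc_of_le hab]; exact T.lipschitz.comp_lipschitzOnWith hu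
    rw [← hT.absolutelyContinuousOnInterval.integral_deriv_eq_sub,
      ← ContinuousLinearMap.intervalIntegral_comp_comm T hint]
    refine intervalIntegral.integral_congr_ae ?_
    filter_upwards [hd] with t ht h2
    exact ((T.hasFDerivAt.comp_hasDerivAt t (ht h2)).deriv).symm
  apply Complex.ext
  · simpa using key Complex.reCLM
  · simpa using key Complex.imCLM

/-- The integral of a derivative over a closed curve vanishes. -/
lemma IsLipschitzLoop.curveInt_deriv {γ : ℝ → ℂ} (h : IsLipschitzLoop γ) {W : Set ℂ}
    (hW : IsOpen W) (hγ : curveTrace γ ⊆ W) {G G' : ℂ → ℂ} (hG : ∀ z ∈ W, HasDerivAt G (G' z) z) :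
    curveInt γ G' = 0 := by
  obtain ⟨K, hK⟩ := h.lipschitz
  have hGd : DifferentiableOn ℂ G W := fun z hz => (hG z hz).differentiableAt.differentiableWithinAt
  -- `G` is Lipschitz only locally on `W`; compactness of `[0, 1]` yields one constant for `G ∘ γ`.
  have hLip : LocallyLipschitzOn (Icc 0 1) (fun t => G (γ t)) := by
    intro t ht
    have hW' : W ∈ 𝓝 (γ t) := hW.mem_nhds (hγ (mem_curveTrace ht))
    obtain ⟨C, T, hT, hC⟩ :=
      ((hGd.analyticAt hW').contDiffAt (n := 1)).exists_lipschitzOnWith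
    refine ⟨C * K, γ ⁻¹' T ∩ Icc 0 1, inter_mem ((h.continuousOn t ht) hT) self_mem_nhdsWithin, ?_⟩
    exact hC.comp (hK.mono inter_subset_right) fun x hx => hx.1
  obtain ⟨C, hC⟩ := hLip.exists_lipschitzOnWith_of_compact isCompact_Icc
  have h1 := hC.integral_deriv_eq_sub_complex zero_le_one
  rw [← h.closed, sub_self] at h1
  rw [curveInt, ← h1]
  refine intervalIntegral.integral_congr_ae (IsLipschitzLoop.ae_uIoc ?_)
  filter_upwards [h.ae_hasDerivAt] with t ht h2
  exact (((hG _ (hγ (mem_curveTrace (Ioo_subset_Icc_self h2)))).comp t (ht h2)).deriv).symm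

/-- Holomorphic dependence of a curve integral on a parameter. -/
lemma IsLipschitzLoop.hasDerivAt_curveInt {γ : ℝ → ℂ} (h : IsLipschitzLoop γ)
    {H : ℂ → ℂ → ℂ} {z₀ : ℂ} {ρ M : ℝ} (hρ : 0 < ρ)
    (hc : ∀ z ∈ Metric.ball z₀ ρ, ContinuousOn (H z) (curveTrace γ))
    (hd : ∀ s ∈ curveTrace γ, DifferentiableOn ℂ (fun z => H z s) (Metric.ball z₀ ρ))
    (hM : ∀ z ∈ Metric.ball z₀ ρ, ∀ s ∈ curveTrace γ, ‖H z s‖ ≤ M) :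
    HasDerivAt (fun z => curveInt γ (H z)) (curveInt γ fun s => deriv (fun z => H z s) z₀) z₀ := by
  obtain ⟨L, hL0, hL⟩ := h.exists_norm_deriv_le
  have hz₀ : z₀ ∈ Metric.ball z₀ ρ := Metric.mem_ball_self hρ
  have hM0 : 0 ≤ M :=
    (norm_nonneg _).trans (hM z₀ hz₀ (γ 0) (mem_curveTrace (by simp)))
  have hder : ∀ z ∈ Metric.ball z₀ ρ, ∀ s ∈ curveTrace γ,
      HasDerivAt (fun z => H z s) (deriv (fun z => H z s) z) z := fun z hz s hs =>
    ((hd s hs).differentiableAt (Metric.isOpen_ball.mem_nhds hz)).hasDerivAt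
  -- Cauchy's estimate on circles of radius `ρ / 4` provides the dominating constant.
  have hbd : ∀ z ∈ Metric.ball z₀ (ρ / 2), ∀ s ∈ curveTrace γ,
      ‖deriv (fun z => H z s) z‖ ≤ M / (ρ / 4) := by
    intro z hz s hs
    have hsub : Metric.closedBall z (ρ / 4) ⊆ Metric.ball z₀ ρ := by
      intro w hw
      rw [Metric.mem_ball, Metric.mem_closedBall] at *
      linarith [dist_triangle w z z₀]
    refine Complex.norm_deriv_le_of_forall_mem_sphere_norm_le (by positivity) ?_ ?_
    · exact ((hd s hs).mono hsub).diffContOnCl_ball subset_rfl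
    · exact fun w hw => hM w (hsub (Metric.sphere_subset_closedBall hw)) s hs
  -- No joint continuity is assumed, so the parameter derivative is measurable as a limit of
  -- difference quotients along a sequence `c n → 0`.
  have hmeas : AEStronglyMeasurable (fun t => deriv (fun z => H z (γ t)) z₀ * deriv γ t)
      (volume.restrict (uIoc (0 : ℝ) 1)) := by
    let c : ℕ → ℂ := fun n => ((ρ / (2 * ((n : ℝ) + 1)) : ℝ) : ℂ)
    have hcpos : ∀ n : ℕ, 0 < ρ / (2 * ((n : ℝ) + 1)) := fun n => by positivity
    have hcb : ∀ n, z₀ + c n ∈ Metric.ball z₀ ρ := by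
      intro n
      simp only [c, Metric.mem_ball, dist_self_add_left, Complex.norm_real, Real.norm_eq_abs,
        abs_of_pos (hcpos n)]
      rw [div_lt_iff₀ (by positivity)]
      have : (0 : ℝ) ≤ n := n.cast_nonneg
      nlinarith
    have hct : Tendsto c atTop (𝓝[≠] 0) := by
      rw [tendsto_nhdsWithin_iff]
      constructor
      · have h1 : Tendsto (fun n : ℕ => (ρ / 2) * (1 / ((n : ℝ) + 1))) atTop (𝓝 (ρ / 2 * 0)) :=
          tendsto_one_div_add_atTop_nhds_zero_nat.const_mul _
        rw [mul_zero] at h1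
        have h2 := (Complex.continuous_ofReal.tendsto 0).comp h1
        rw [Complex.ofReal_zero] at h2
        refine h2.congr fun n => ?_
        simp only [Function.comp, c]
        congr 1
        field_simp
      · refine Eventually.of_forall fun n => ?_
        simp only [c, mem_compl_iff, mem_singleton_iff, Complex.ofReal_eq_zero]
        exact (hcpos n).ne'
    refine aestronglyMeasurable_of_tendsto_ae atTop
      (f := fun n t => (c n)⁻¹ * ((H (z₀ + c n) (γ t) - H z₀ (γ t)) * deriv γ t)) ?_ ?_
    · intro n
      exact (h.aestronglyMeasurable ((hc _ (hcb n)).sub (hc _ hz₀))).const_mul _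
    · refine ae_restrict_uIoc (ae_of_all _ fun t ht => ?_)
      have h1 := (hder z₀ hz₀ _ (mem_curveTrace (Ioo_subset_Icc_self ht))).tendsto_slope_zero.comp hct
      simpa [Function.comp_def, mul_assoc] using h1.mul_const (deriv γ t)
  refine (intervalIntegral.hasDerivAt_integral_of_dominated_loc_of_deriv_le
    (F := fun z t => H z (γ t) * deriv γ t)
    (F' := fun z t => deriv (fun z => H z (γ t)) z * deriv γ t)
    (bound := fun _ => M / (ρ / 4) * L) (Metric.ball_mem_nhds z₀ (half_pos hρ)) ?_ ?_ hmeas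
    ?_ (by simp) ?_).2
  · filter_upwards [Metric.ball_mem_nhds z₀ hρ] with z hz
    exact h.aestronglyMeasurable (hc z hz)
  · exact h.intervalIntegrable (hc z₀ hz₀)
  · refine ae_uIoc (ae_of_all _ fun t ht z hz => ?_)
    rw [norm_mul]
    exact mul_le_mul (hbd z hz _ (mem_curveTrace (Ioo_subset_Icc_self ht))) (hL t ht)
      (norm_nonneg _) (by positivity)
  · refine ae_uIoc (ae_of_all _ fun t ht z hz => ?_)
    exact (hder z (Metric.ball_subset_ball (by linarith) hz) _
      (mem_curveTrace (Ioo_subset_Icc_self ht))).mul_const _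


/-! ### Winding numbers and Cauchy's theorem -/

namespace IsLipschitzLoop

variable {γ : ℝ → ℂ}

lemma exists_closedBall (h : IsLipschitzLoop γ) :
    ∃ R : ℝ, 0 < R ∧ ∀ s ∈ curveTrace γ, ‖s‖ ≤ R := by
  obtain ⟨R, hR⟩ := h.isCompact_curveTrace.exists_bound_of_continuousOn continuousOn_id
  exact ⟨max R 1, by positivity, fun s hs => (hR s hs).trans (le_max_left _ _)⟩

lemma continuousOn_cauchyKernel {F : ℂ → ℂ} (hF : ContinuousOn F (curveTrace γ)) {z : ℂ}
    (hz : z ∉ curveTrace γ) : ContinuousOn (fun s => F s * (s - z)⁻¹) (curveTrace γ) := by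
  refine hF.mul ((continuousOn_id.sub continuousOn_const).inv₀ fun s hs => ?_)
  refine sub_ne_zero.2 ?_
  rintro rfl
  exact hz hs

/-- `log (1 - s / z)` is a primitive on the disc `|s| < |z|`. -/
lemma curveInt_inv_eq_zero (h : IsLipschitzLoop γ) {z : ℂ} (hz : ∀ s ∈ curveTrace γ, ‖s‖ < ‖z‖) :
    curveInt γ (fun s => (s - z)⁻¹) = 0 := by
  have hz0 : z ≠ 0 := by
    rintro rfl
    have := hz (γ 0) (mem_curveTrace (by simp))
    rw [norm_zero] at this
    exact absurd this (norm_nonneg _).not_gt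
  refine h.curveInt_deriv (W := Metric.ball 0 ‖z‖) Metric.isOpen_ball (fun s hs => by simpa using hz s hs)
    (G := fun s => Complex.log (1 - s / z)) fun s hs => ?_
  have hs' : ‖s / z‖ < 1 := by
    rw [norm_div, div_lt_one (by positivity)]
    simpa using hs
  have hslit : 1 - s / z ∈ Complex.slitPlane := by
    have := Complex.mem_slitPlane_of_norm_lt_one (z := -(s / z)) (by simpa using hs')
    simpa [sub_eq_add_neg] using this
  have hne : s - z ≠ 0 := by
    rw [sub_ne_zero]
    rintro rfl
    simp at hs
  have h1 : HasDerivAt (fun s : ℂ => 1 - s / z) (-(1 / z)) s := by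
    simpa using ((hasDerivAt_id s).div_const z).const_sub 1
  convert h1.clog hslit using 1
  have : 1 - s / z ≠ 0 := Complex.slitPlane_ne_zero hslit
  have h3 : z - s ≠ 0 := by rw [← neg_sub]; exact neg_ne_zero.2 hne
  field_simp
  ring

/-- The two integrands differ by the derivative of `log ((s - z) / (s - z₀))`. For `|z - z₀| < |s -
z₀|` this quotient lies in the unit disc around `1`, so the logarithm is holomorphic near the curve.
-/
lemma eventually_curveInt_inv_eq (h : IsLipschitzLoop γ) {z₀ : ℂ} (hz₀ : z₀ ∉ curveTrace γ) :
    ∀ᶠ z in 𝓝 z₀, curveInt γ (fun s => (s - z)⁻¹) = curveInt γ (fun s => (s - z₀)⁻¹) := by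
  obtain ⟨ρ, hρ, hball⟩ := Metric.isOpen_iff.1 h.isOpen_compl_curveTrace z₀ hz₀
  have hsep : ∀ s ∈ curveTrace γ, ρ ≤ ‖s - z₀‖ := fun s hs => by
    by_contra! hlt
    exact hball (by simpa [dist_eq_norm] using hlt) hs
  filter_upwards [Metric.ball_mem_nhds z₀ hρ] with z hz
  have hz' : ‖z - z₀‖ < ρ := by simpa [dist_eq_norm] using hz
  have hcont : ∀ w ∈ Metric.ball z₀ ρ, ContinuousOn (fun s => (s - w)⁻¹) (curveTrace γ) := by
    intro w hw
    simpa using continuousOn_cauchyKernel (F := fun _ => 1) continuousOn_const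
      (fun hs => hball hw hs)
  rw [← sub_eq_zero, ← h.curveInt_sub (hcont z hz) (hcont z₀ (Metric.mem_ball_self hρ))]
  refine h.curveInt_deriv (W := {s | ‖z - z₀‖ < ‖s - z₀‖})
    (isOpen_lt continuous_const (by fun_prop)) (fun s hs => hz'.trans_le (hsep s hs))
    (G := fun s => Complex.log ((s - z) / (s - z₀))) fun s hs => ?_
  have hs' : ‖z - z₀‖ < ‖s - z₀‖ := hs
  have hpos : 0 < ‖s - z₀‖ := (norm_nonneg _).trans_lt hs'
  have hne : s - z₀ ≠ 0 := norm_pos_iff.1 hpos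
  have hlt : ‖-((z - z₀) / (s - z₀))‖ < 1 := by
    rw [norm_neg, norm_div, div_lt_one hpos]
    exact hs'
  have heq : (s - z) / (s - z₀) = 1 + -((z - z₀) / (s - z₀)) := by
    field_simp
    ring
  have hslit : (s - z) / (s - z₀) ∈ Complex.slitPlane := by
    rw [heq]; exact Complex.mem_slitPlane_of_norm_lt_one hlt
  have hne2 : s - z ≠ 0 := by
    intro h0
    rw [h0, zero_div] at hslit
    exact Complex.slitPlane_ne_zero hslit rfl
  have h1 : HasDerivAt (fun s : ℂ => (s - z) / (s - z₀))
      ((1 * (s - z₀) - (s - z) * 1) / (s - z₀) ^ 2) s :=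
    ((hasDerivAt_id s).sub_const z).div ((hasDerivAt_id s).sub_const z₀) hne
  convert h1.clog hslit using 1
  field_simp

/-- Cauchy integrals are holomorphic off the curve. -/
lemma differentiableAt_cauchyIntegral (h : IsLipschitzLoop γ) {F : ℂ → ℂ}
    (hF : ContinuousOn F (curveTrace γ)) {z₀ : ℂ} (hz₀ : z₀ ∉ curveTrace γ) :
    DifferentiableAt ℂ (fun z => curveInt γ (fun s => F s * (s - z)⁻¹)) z₀ := by
  obtain ⟨ρ, hρ, hball⟩ := Metric.isOpen_iff.1 h.isOpen_compl_curveTrace z₀ hz₀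
  obtain ⟨M, hM⟩ := h.isCompact_curveTrace.exists_bound_of_continuousOn hF
  have hsep : ∀ s ∈ curveTrace γ, ρ ≤ ‖s - z₀‖ := fun s hs => by
    by_contra! hlt
    exact hball (by simpa [dist_eq_norm] using hlt) hs
  have hsep2 : ∀ z ∈ Metric.ball z₀ (ρ / 2), ∀ s ∈ curveTrace γ, ρ / 2 ≤ ‖s - z‖ := by
    intro z hz s hs
    rw [Metric.mem_ball, dist_eq_norm] at hz
    have := norm_sub_le_norm_sub_add_norm_sub s z z₀
    linarith [hsep s hs]
  refine (h.hasDerivAt_curveInt (H := fun z s => F s * (s - z)⁻¹) (half_pos hρ)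
    (M := M * (ρ / 2)⁻¹) ?_ ?_ ?_).differentiableAt
  · exact fun z hz => continuousOn_cauchyKernel hF
      fun hs => hball (Metric.ball_subset_ball (by linarith) hz) hs
  · intro s hs z hz
    have : s - z ≠ 0 := norm_pos_iff.1 ((half_pos hρ).trans_le (hsep2 z hz s hs))
    exact ((differentiableAt_const _).mul
      (((differentiableAt_const s).sub differentiableAt_id).inv this)).differentiableWithinAt
  · intro z hz s hs
    rw [norm_mul, norm_inv]
    exact mul_le_mul (hM s hs) (inv_anti₀ (half_pos hρ) (hsep2 z hz s hs)) (by positivity)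
      ((norm_nonneg _).trans (hM s hs))

lemma tendsto_cauchyIntegral_cocompact (h : IsLipschitzLoop γ) {F : ℂ → ℂ}
    (hF : ContinuousOn F (curveTrace γ)) :
    Tendsto (fun z => curveInt γ (fun s => F s * (s - z)⁻¹)) (cocompact ℂ) (𝓝 0) := by
  obtain ⟨M, hM⟩ := h.isCompact_curveTrace.exists_bound_of_continuousOn hF
  obtain ⟨R, hR0, hR⟩ := h.exists_closedBall
  obtain ⟨L, hL0, hL⟩ := h.exists_norm_curveInt_le
  have hM0 : 0 ≤ M := (norm_nonneg _).trans (hM (γ 0) (mem_curveTrace (by simp)))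
  have ht : Tendsto (fun z : ℂ => L * (M * (‖z‖ - R)⁻¹)) (cocompact ℂ) (𝓝 (L * (M * 0))) := by
    refine ((Tendsto.inv_tendsto_atTop ?_).const_mul _).const_mul _
    exact tendsto_atTop_add_const_right _ _ (tendsto_norm_cocompact_atTop)
  rw [mul_zero, mul_zero] at ht
  refine squeeze_zero_norm' ?_ ht
  filter_upwards [(tendsto_norm_cocompact_atTop (E := ℂ)).eventually_gt_atTop R] with z hz
  refine hL _ _ (mul_nonneg hM0 (inv_nonneg.2 (by linarith))) fun s hs => ?_
  rw [norm_mul, norm_inv]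
  have : ‖z‖ - R ≤ ‖s - z‖ := by
    have := norm_sub_norm_le z s
    rw [norm_sub_rev] at this
    linarith [hR s hs]
  exact mul_le_mul (hM s hs) (inv_anti₀ (by linarith) this) (by positivity) hM0

end IsLipschitzLoop

/-- Symmetry, including the diagonal, turns holomorphy in one argument into holomorphy in the other.
-/
lemma dslope_comm (G : ℂ → ℂ) (a b : ℂ) : dslope G a b = dslope G b a := by
  rcases eq_or_ne a b with rfl | hab
  · rfl
  · rw [dslope_of_ne _ hab.symm, dslope_of_ne _ hab, slope_comm]

lemma norm_dslope_le {G : ℂ → ℂ} {a b : ℂ} {M ρ : ℝ} (hρ : 0 < ρ) (hab : ρ ≤ ‖b - a‖)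
    (ha : ‖G a‖ ≤ M) (hb : ‖G b‖ ≤ M) : ‖dslope G a b‖ ≤ 2 * M / ρ := by
  have hpos : 0 < ‖b - a‖ := hρ.trans_le hab
  rw [dslope_of_ne _ (sub_ne_zero.1 (norm_pos_iff.1 hpos)), slope_def_field, norm_div]
  have h1 : ‖G b - G a‖ ≤ 2 * M := (norm_sub_le _ _).trans (by linarith)
  have hM0 : 0 ≤ M := (norm_nonneg _).trans ha
  gcongr

/-- The integral of the difference quotients of a holomorphic function is holomorphic, also at the
points of the curve. -/
lemma IsLipschitzLoop.differentiableAt_curveInt_dslope {γ : ℝ → ℂ} (h : IsLipschitzLoop γ)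
    {W : Set ℂ} (hW : IsOpen W) (hγ : curveTrace γ ⊆ W) {G : ℂ → ℂ} (hG : DifferentiableOn ℂ G W)
    {z₀ : ℂ} (hz₀ : z₀ ∈ W) : DifferentiableAt ℂ (fun z => curveInt γ (dslope G z)) z₀ := by
  obtain ⟨r, hr, hball⟩ := Metric.nhds_basis_closedBall.mem_iff.1 (hW.mem_nhds hz₀)
  set ρ := r / 2 with hρdef
  have hρ : 0 < ρ := half_pos hr
  have hcomp : IsCompact (curveTrace γ ∪ Metric.closedBall z₀ r) :=
    h.isCompact_curveTrace.union (isCompact_closedBall _ _)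
  obtain ⟨M, hM⟩ := hcomp.exists_bound_of_continuousOn
    (hG.continuousOn.mono (union_subset hγ hball))
  have hM0 : 0 ≤ M := (norm_nonneg _).trans (hM z₀ (Or.inr (Metric.mem_closedBall_self hr.le)))
  have hdiff : ∀ s ∈ W, DifferentiableOn ℂ (dslope G s) W := fun s hs =>
    (Complex.differentiableOn_dslope (hW.mem_nhds hs)).2 hG
  have hsubW : Metric.ball z₀ (ρ / 2) ⊆ W := fun z hz => hball (by
    rw [Metric.mem_closedBall]; rw [Metric.mem_ball] at hz; linarith)
  refine (h.hasDerivAt_curveInt (H := fun z s => dslope G z s) (half_pos hρ)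
    (M := 2 * M / (ρ / 2)) ?_ ?_ ?_).differentiableAt
  · exact fun z hz => (hdiff z (hsubW hz)).continuousOn.mono hγ
  · intro s hs
    simp_rw [dslope_comm G _ s]
    exact (hdiff s (hγ hs)).mono hsubW
  · intro z hz s hs
    rw [Metric.mem_ball, dist_eq_norm] at hz
    -- Far from `z₀` the denominator is bounded below. Near `z₀` the quotient, as a function of its
    -- other argument, is bounded by the maximum principle on the disc of radius `r`, whose boundary
    -- stays at distance `ρ` from `s`.
    rcases le_or_gt ρ ‖s - z₀‖ with hs1 | hs1
    · refine norm_dslope_le (half_pos hρ) ?_ (hM z (Or.inr ?_)) (hM s (Or.inl hs))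
      · have := norm_sub_le_norm_sub_add_norm_sub s z z₀
        linarith
      · rw [Metric.mem_closedBall, dist_eq_norm]; linarith
    · rw [dslope_comm]
      refine Complex.norm_le_of_forall_mem_frontier_norm_le (Metric.isBounded_ball (x := z₀) (r := r))
        (((hdiff s (hγ hs)).mono hball).diffContOnCl_ball subset_rfl) ?_ (subset_closure ?_)
      · intro w hw
        rw [frontier_ball _ hr.ne', mem_sphere_iff_norm] at hw
        refine norm_dslope_le (half_pos hρ) ?_ (hM s (Or.inl hs)) (hM w (Or.inr ?_))
        · have := norm_sub_le_norm_sub_add_norm_sub w s z₀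
          linarith
        · rw [Metric.mem_closedBall, dist_eq_norm]; exact hw.le
      · rw [Metric.mem_ball, dist_eq_norm]; linarith

/-- This identity allows difference quotient integrals to be glued to Cauchy integrals wherever the
winding number is known. -/
lemma IsLipschitzLoop.curveInt_dslope_eq {γ : ℝ → ℂ} (h : IsLipschitzLoop γ) {G : ℂ → ℂ}
    (hG : ContinuousOn G (curveTrace γ)) {z : ℂ} (hz : z ∉ curveTrace γ) :
    curveInt γ (dslope G z) =
      curveInt γ (fun s => G s * (s - z)⁻¹) - G z * curveInt γ (fun s => (s - z)⁻¹) := by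
  have h1 : ContinuousOn (fun s => (s - z)⁻¹) (curveTrace γ) := by
    simpa using continuousOn_cauchyKernel (F := fun _ => 1) continuousOn_const hz
  rw [← curveInt_const_mul, ← h.curveInt_sub (continuousOn_cauchyKernel hG hz)
    ((continuousOn_const (c := G z)).fun_mul h1)]
  refine curveInt_congr fun s hs => ?_
  have hne : s ≠ z := by rintro rfl; exact hz hs
  rw [dslope_of_ne _ hne, slope_def_field]
  ring

/-- Cauchy's theorem in its homological form: the integrals of a holomorphic function along two
closed curves that wind equally often around every point outside the domain are equal. -/
theorem curveInt_eq_of_homologous {γ₁ γ₂ : ℝ → ℂ} (h₁ : IsLipschitzLoop γ₁)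
    (h₂ : IsLipschitzLoop γ₂) {W : Set ℂ} (hW : IsOpen W) (hγ₁ : curveTrace γ₁ ⊆ W)
    (hγ₂ : curveTrace γ₂ ⊆ W)
    (hw : ∀ z ∉ W, curveInt γ₁ (fun s => (s - z)⁻¹) = curveInt γ₂ (fun s => (s - z)⁻¹))
    {G : ℂ → ℂ} (hG : DifferentiableOn ℂ G W) : curveInt γ₁ G = curveInt γ₂ G := by
  classical
  set a := γ₁ 0
  have ha : a ∈ W := hγ₁ (mem_curveTrace (by simp))
  -- The factor `s - a` is chosen so that the difference quotient of `F` at `a` is `G`; the value `E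
  -- a` below is then the difference of the two integrals.
  let F : ℂ → ℂ := fun s => (s - a) * G s
  have hF : DifferentiableOn ℂ F W := (differentiableOn_id.sub_const a).mul hG
  let C : ℂ → ℂ := fun z =>
    curveInt γ₁ (fun s => F s * (s - z)⁻¹) - curveInt γ₂ (fun s => F s * (s - z)⁻¹)
  let J : ℂ → ℂ := fun z => curveInt γ₁ (dslope F z) - curveInt γ₂ (dslope F z)
  -- Dixon's function: the two formulas agree where the winding numbers agree, in particular near
  -- every point outside `W`. So `E` is entire; it tends to `0` at infinity and vanishes by
  -- Liouville's theorem.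
  let E : ℂ → ℂ := fun z => if z ∈ W then J z else C z
  have hJC : ∀ z, z ∉ curveTrace γ₁ → z ∉ curveTrace γ₂ →
      curveInt γ₁ (fun s => (s - z)⁻¹) = curveInt γ₂ (fun s => (s - z)⁻¹) → E z = C z := by
    intro z hz1 hz2 hzw
    by_cases hz : z ∈ W
    · simp only [E, if_pos hz, J, C, h₁.curveInt_dslope_eq (hF.continuousOn.mono hγ₁) hz1,
        h₂.curveInt_dslope_eq (hF.continuousOn.mono hγ₂) hz2, hzw]
      ring
    · simp only [E, if_neg hz]
  have hEd : Differentiable ℂ E := by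
    intro z₀
    by_cases hz : z₀ ∈ W
    · refine DifferentiableAt.congr_of_eventuallyEq (f := J) ?_ ?_
      · exact (h₁.differentiableAt_curveInt_dslope hW hγ₁ hF hz).sub
          (h₂.differentiableAt_curveInt_dslope hW hγ₂ hF hz)
      · filter_upwards [hW.mem_nhds hz] with z hz
        simp only [E, if_pos hz]
    · have hz1 : z₀ ∉ curveTrace γ₁ := fun h => hz (hγ₁ h)
      have hz2 : z₀ ∉ curveTrace γ₂ := fun h => hz (hγ₂ h)
      refine DifferentiableAt.congr_of_eventuallyEq (f := C) ?_ ?_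
      · exact (h₁.differentiableAt_cauchyIntegral (hF.continuousOn.mono hγ₁) hz1).sub
          (h₂.differentiableAt_cauchyIntegral (hF.continuousOn.mono hγ₂) hz2)
      · filter_upwards [h₁.eventually_curveInt_inv_eq hz1, h₂.eventually_curveInt_inv_eq hz2,
          h₁.isOpen_compl_curveTrace.mem_nhds hz1, h₂.isOpen_compl_curveTrace.mem_nhds hz2]
          with z e1 e2 m1 m2
        exact hJC z m1 m2 (by rw [e1, e2, hw z₀ hz])
  obtain ⟨R₁, -, hR₁⟩ := h₁.exists_closedBall
  obtain ⟨R₂, -, hR₂⟩ := h₂.exists_closedBall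
  have hE0 : Tendsto E (cocompact ℂ) (𝓝 0) := by
    have hC0 := (h₁.tendsto_cauchyIntegral_cocompact (hF.continuousOn.mono hγ₁)).sub
      (h₂.tendsto_cauchyIntegral_cocompact (hF.continuousOn.mono hγ₂))
    rw [sub_zero] at hC0
    refine hC0.congr' ?_
    filter_upwards [(tendsto_norm_cocompact_atTop (E := ℂ)).eventually_gt_atTop R₁,
      (tendsto_norm_cocompact_atTop (E := ℂ)).eventually_gt_atTop R₂] with z z1 z2
    refine (hJC z (fun h => (hR₁ z h).not_gt z1) (fun h => (hR₂ z h).not_gt z2) ?_).symm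
    rw [h₁.curveInt_inv_eq_zero fun s hs => (hR₁ s hs).trans_lt z1,
      h₂.curveInt_inv_eq_zero fun s hs => (hR₂ s hs).trans_lt z2]
  have hEa : E a = 0 := hEd.apply_eq_of_tendsto_cocompact a hE0
  have hds : ∀ s ∈ W, dslope F a s = G s := by
    intro s hs
    rcases eq_or_ne s a with hsa | hsa
    · rw [hsa, dslope_same]
      have := ((hasDerivAt_id a).sub_const a).fun_mul (hG.hasDerivAt (hW.mem_nhds ha))
      simpa [F] using this.deriv
    · rw [dslope_of_ne _ hsa, slope_def_field]
      have : s - a ≠ 0 := sub_ne_zero.2 hsa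
      simp [F, this]
  simp only [E, if_pos ha, J] at hEa
  rw [curveInt_congr fun s hs => hds s (hγ₁ hs), curveInt_congr fun s hs => hds s (hγ₂ hs)] at hEa
  exact sub_eq_zero.1 hEa

/-- Cauchy's theorem for a closed curve that does not wind around points outside the domain. -/
theorem IsLipschitzLoop.curveInt_eq_zero {γ : ℝ → ℂ} (h : IsLipschitzLoop γ) {W : Set ℂ}
    (hW : IsOpen W) (hγ : curveTrace γ ⊆ W) (hw : ∀ z ∉ W, curveInt γ (fun s => (s - z)⁻¹) = 0)
    {G : ℂ → ℂ} (hG : DifferentiableOn ℂ G W) : curveInt γ G = 0 := by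
  -- The comparison curve is constant, so all integrals along it vanish.
  have hc : IsLipschitzLoop fun _ => γ 0 := ⟨⟨0, (LipschitzWith.const _).lipschitzOnWith⟩, rfl⟩
  have h0 : ∀ F : ℂ → ℂ, curveInt (fun _ => γ 0) F = 0 := fun F => by simp [curveInt]
  rw [curveInt_eq_of_homologous h hc hW hγ ?_ (fun z hz => by rw [hw z hz, h0]) hG, h0]
  rintro _ ⟨t, -, rfl⟩
  exact hγ (mem_curveTrace (by simp))


/-! ### The exterior of a closed curve -/

/-- The ray is connected, unbounded and off the curve, so the component of its starting point is
unbounded. -/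
lemma not_mem_curveInside_of_ray {γ : ℝ → ℂ} {z d : ℂ} (hd : d ≠ 0)
    (h : ∀ x : ℝ, 0 ≤ x → z + x * d ∉ curveTrace γ) : z ∉ curveInside γ := by
  rintro ⟨-, hb⟩
  obtain ⟨R, hR⟩ := hb.exists_norm_le
  let ray : Set ℂ := (fun x : ℝ => z + x * d) '' Ici 0
  have hpre : IsPreconnected ray :=
    isPreconnected_Ici.image _ (by fun_prop)
  have hsub : ray ⊆ connectedComponentIn (curveTrace γ)ᶜ z :=
    hpre.subset_connectedComponentIn ⟨0, by simp, by simp⟩ (by rintro _ ⟨x, hx, rfl⟩; exact h x hx)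
  have hpos : 0 < ‖d‖ := norm_pos_iff.2 hd
  set x : ℝ := (‖R‖ + ‖z‖ + 1) / ‖d‖ with hx
  have hx0 : 0 ≤ x := by positivity
  have h1 := hR _ (hsub ⟨x, hx0, rfl⟩)
  have h2 : ‖(x : ℂ) * d‖ = ‖R‖ + ‖z‖ + 1 := by
    rw [norm_mul, Complex.norm_real, Real.norm_of_nonneg hx0, hx, div_mul_cancel₀ _ hpos.ne']
  have h3 : ‖(x : ℂ) * d‖ ≤ ‖z + x * d‖ + ‖z‖ := by
    have := norm_sub_le (z + x * d) z
    simpa using this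
  linarith [le_abs_self R, Real.norm_eq_abs R]

namespace IsLipschitzLoop

variable {γ : ℝ → ℂ}

/-- From a point beyond radius `R` the radial ray escapes without meeting the curve. -/
lemma curveInside_subset_closedBall {R : ℝ} (hR : ∀ s ∈ curveTrace γ, ‖s‖ ≤ R) :
    curveInside γ ⊆ Metric.closedBall 0 R := by
  intro z hz
  by_contra hzR
  rw [mem_closedBall_zero_iff, not_le] at hzR
  have hz0 : z ≠ 0 := by
    rintro rfl
    have := (norm_nonneg _).trans (hR (γ 0) (mem_curveTrace (by simp)))
    simp at hzR
    linarith
  refine not_mem_curveInside_of_ray hz0 (fun x hx hm => ?_) hz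
  have h1 := hR _ hm
  have h2 : z + x * z = ((1 + x : ℝ) : ℂ) * z := by push_cast; ring
  rw [h2, norm_mul, Complex.norm_real, Real.norm_of_nonneg (by linarith)] at h1
  nlinarith [norm_nonneg z]

/-- If all moments of `F` along `γ` vanish, the Cauchy integral of `F` vanishes in the exterior. -/
lemma cauchyIntegral_eq_zero_of_moments (h : IsLipschitzLoop γ) {F : ℂ → ℂ}
    (hF : ContinuousOn F (curveTrace γ)) (hm : ∀ n : ℕ, curveInt γ (fun s => F s * s ^ n) = 0)
    {z : ℂ} (hz : z ∉ curveTrace γ) (hz' : z ∉ curveInside γ) :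
    curveInt γ (fun s => F s * (s - z)⁻¹) = 0 := by
  obtain ⟨R, hR0, hR⟩ := h.exists_closedBall
  obtain ⟨L, hL0, hL⟩ := h.exists_norm_curveInt_le
  obtain ⟨M, hM⟩ := h.isCompact_curveTrace.exists_bound_of_continuousOn hF
  have hM0 : 0 ≤ M := (norm_nonneg _).trans (hM (γ 0) (mem_curveTrace (by simp)))
  have hfar : ∀ w : ℂ, R < ‖w‖ → curveInt γ (fun s => F s * (s - w)⁻¹) = 0 := by
    intro w hw
    have hw0 : 0 < ‖w‖ := hR0.trans hw
    have hwt : w ∉ curveTrace γ := fun hs => (hR w hs).not_gt hw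
    have hwne : w ≠ 0 := norm_pos_iff.1 hw0
    -- `s ^ N - w ^ N` is divisible by `s - w`, and the quotient is a polynomial in `s`, annihilated
    -- by the moments. The Cauchy integral at `w` is therefore `O((R / |w|) ^ N)` for every `N`.
    have hid : ∀ N : ℕ, curveInt γ (fun s => F s * s ^ N * (s - w)⁻¹) =
        w ^ N * curveInt γ (fun s => F s * (s - w)⁻¹) := by
      intro N
      have h1 : curveInt γ (fun s => F s * s ^ N * (s - w)⁻¹) =
          curveInt γ (fun s => w ^ N * (F s * (s - w)⁻¹) +
            ∑ i ∈ Finset.range N, w ^ (N - 1 - i) * (F s * s ^ i)) := by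
        refine curveInt_congr fun s hs => ?_
        have hne : s - w ≠ 0 := sub_ne_zero.2 (by rintro rfl; exact hwt hs)
        have := geom_sum₂_mul s w N
        have h2 : s ^ N = w ^ N + (∑ i ∈ Finset.range N, s ^ i * w ^ (N - 1 - i)) * (s - w) := by
          rw [this]; ring
        rw [h2, mul_add, add_mul]
        congr 1
        · ring
        · rw [mul_assoc, mul_assoc, mul_inv_cancel₀ hne, mul_one, Finset.mul_sum]
          exact Finset.sum_congr rfl fun i _ => by ring
      have hc : ∀ i, ContinuousOn (fun s => w ^ (N - 1 - i) * (F s * s ^ i)) (curveTrace γ) :=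
        fun i => continuousOn_const.mul (hF.mul (continuousOn_id.pow i))
      rw [h1, h.curveInt_add (F := fun s => w ^ N * (F s * (s - w)⁻¹))
        (continuousOn_const.mul (continuousOn_cauchyKernel hF hwt))
        (continuousOn_finsetSum _ fun i _ => hc i), curveInt_const_mul,
        h.curveInt_finset_sum _ fun i _ => hc i]
      simp [curveInt_const_mul, hm]
    have hle : ∀ N : ℕ, ‖curveInt γ (fun s => F s * (s - w)⁻¹)‖ ≤
        L * (M * (‖w‖ - R)⁻¹) * (R / ‖w‖) ^ N := by
      intro N
      have h1 := hL (fun s => F s * s ^ N * (s - w)⁻¹) (M * R ^ N * (‖w‖ - R)⁻¹)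
        (mul_nonneg (by positivity) (inv_nonneg.2 (by linarith))) fun s hs => by
          rw [norm_mul, norm_mul, norm_pow, norm_inv]
          have : ‖w‖ - R ≤ ‖s - w‖ := by
            have := norm_sub_norm_le w s
            rw [norm_sub_rev] at this
            linarith [hR s hs]
          gcongr
          · exact hM s hs
          · exact hR s hs
      rw [hid, norm_mul, norm_pow] at h1
      rw [div_pow, ← mul_div_assoc, le_div_iff₀ (by positivity)]
      linarith
    have ht : Tendsto (fun N : ℕ => L * (M * (‖w‖ - R)⁻¹) * (R / ‖w‖) ^ N) atTop
        (𝓝 (L * (M * (‖w‖ - R)⁻¹) * 0)) :=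
      (tendsto_pow_atTop_nhds_zero_of_lt_one (by positivity)
        ((div_lt_one hw0).2 hw)).const_mul _
    rw [mul_zero] at ht
    exact norm_le_zero_iff.1 (ge_of_tendsto' ht hle)
  have hub : ¬ Bornology.IsBounded (connectedComponentIn (curveTrace γ)ᶜ z) :=
    fun hb => hz' ⟨hz, hb⟩
  -- An unbounded component reaches the far region where the integral is already zero; the identity
  -- theorem carries this back to `z`.
  obtain ⟨w, hwC, hw⟩ : ∃ w ∈ connectedComponentIn (curveTrace γ)ᶜ z, R < ‖w‖ := by
    by_contra! hcon
    exact hub ((Metric.isBounded_closedBall (x := (0 : ℂ)) (r := R)).subset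
      fun w hw => mem_closedBall_zero_iff.2 (hcon w hw))
  have hopen : IsOpen (connectedComponentIn (curveTrace γ)ᶜ z) :=
    h.isOpen_compl_curveTrace.connectedComponentIn
  have han : AnalyticOnNhd ℂ (fun z => curveInt γ (fun s => F s * (s - z)⁻¹))
      (connectedComponentIn (curveTrace γ)ᶜ z) := by
    refine DifferentiableOn.analyticOnNhd (fun w hw => ?_) hopen
    exact (h.differentiableAt_cauchyIntegral hF
      (connectedComponentIn_subset _ _ hw)).differentiableWithinAt
  refine han.eqOn_of_preconnected_of_eventuallyEq (g := fun _ => 0) analyticOnNhd_const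
    isPreconnected_connectedComponentIn hwC ?_ (mem_connectedComponentIn hz)
  filter_upwards [(isOpen_lt continuous_const continuous_norm).mem_nhds hw] with v hv
  exact hfar v hv

/-- The constant `1` has vanishing moments, because powers have primitives. -/
lemma winding_eq_zero (h : IsLipschitzLoop γ) {z : ℂ} (hz : z ∉ curveTrace γ)
    (hz' : z ∉ curveInside γ) : curveInt γ (fun s => (s - z)⁻¹) = 0 := by
  have := h.cauchyIntegral_eq_zero_of_moments (F := fun _ => 1) continuousOn_const (fun n => ?_)
    hz hz'
  · simpa using this
  · refine h.curveInt_deriv isOpen_univ (subset_univ _) (G := fun s => s ^ (n + 1) / (n + 1 : ℕ))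
      fun s _ => ?_
    have := (hasDerivAt_pow (n + 1) s).div_const ((n + 1 : ℕ) : ℂ)
    have hne : ((n + 1 : ℕ) : ℂ) ≠ 0 := Nat.cast_ne_zero.2 n.succ_ne_zero
    rwa [mul_div_cancel_left₀ _ hne, Nat.add_sub_cancel, ← one_mul (s ^ n)] at this

/-- The exponential transform of a function on a curve. -/
lemma hasDerivAt_curveInt_exp (h : IsLipschitzLoop γ) {F : ℂ → ℂ}
    (hF : ContinuousOn F (curveTrace γ)) (t : ℂ) :
    HasDerivAt (fun t => curveInt γ (fun s => Complex.exp (t * s) * F s))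
      (curveInt γ (fun s => Complex.exp (t * s) * (F s * s))) t := by
  obtain ⟨R, hR0, hR⟩ := h.exists_closedBall
  obtain ⟨M, hM⟩ := h.isCompact_curveTrace.exists_bound_of_continuousOn hF
  have hd : ∀ s w : ℂ, HasDerivAt (fun t => Complex.exp (t * s) * F s)
      (Complex.exp (w * s) * (F s * s)) w := fun s w => by
    have := ((hasDerivAt_mul_const (x := w) s).cexp).mul_const (F s)
    rwa [mul_assoc, mul_comm s] at this
  have := h.hasDerivAt_curveInt (H := fun t s => Complex.exp (t * s) * F s) (z₀ := t) one_pos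
    (M := Real.exp ((‖t‖ + 1) * R) * M) (fun z _ => ContinuousOn.mul (by fun_prop) hF)
    (fun s _ w _ => (hd s w).differentiableAt.differentiableWithinAt) (fun z hz s hs => ?_)
  · simpa only [(hd _ _).deriv] using this
  · rw [norm_mul]
    have h1 : ‖z‖ ≤ ‖t‖ + 1 := by
      rw [Metric.mem_ball, dist_eq_norm] at hz
      linarith [norm_sub_norm_le z t]
    have h2 : ‖Complex.exp (z * s)‖ ≤ Real.exp ((‖t‖ + 1) * R) := by
      refine (Complex.norm_exp_le_exp_norm _).trans (Real.exp_le_exp.2 ?_)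
      rw [norm_mul]
      exact mul_le_mul h1 (hR s hs) (norm_nonneg _) (by positivity)
    exact mul_le_mul h2 (hM s hs) (norm_nonneg _) (Real.exp_nonneg _)

/-- Each derivative in `t` brings down a factor `s`; the moments are the derivatives at `t = 0`. -/
lemma moments_eq_zero (h : IsLipschitzLoop γ) {F : ℂ → ℂ} (hF : ContinuousOn F (curveTrace γ))
    (h0 : ∀ t : ℂ, curveInt γ (fun s => Complex.exp (t * s) * F s) = 0) (n : ℕ) :
    curveInt γ (fun s => F s * s ^ n) = 0 := by
  have key : ∀ t : ℂ, curveInt γ (fun s => Complex.exp (t * s) * (F s * s ^ n)) = 0 := by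
    induction n with
    | zero => simpa using h0
    | succ n ih =>
      intro t
      have h1 := h.hasDerivAt_curveInt_exp (F := fun s => F s * s ^ n)
        (hF.mul (continuousOn_id.pow n)) t
      simp only [ih] at h1
      have h2 := h1.unique (hasDerivAt_const t (0 : ℂ))
      simpa only [pow_succ, mul_assoc] using h2
  simpa using key 0

end IsLipschitzLoop

/-! ### Curves in the plane without two half-lines -/

lemma isOpen_zetaDomain (h : ℝ) : IsOpen (zetaDomain h) := by
  have : zetaDomain h = {s : ℂ | 0 ≤ s.re ∧ |s.im| = Real.sqrt (h - 1)}ᶜ := rfl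
  rw [this, isOpen_compl_iff]
  exact (isClosed_le continuous_const Complex.continuous_re).inter
    (isClosed_eq Complex.continuous_im.abs continuous_const)

/-- A removed point can run to the right along its own half-line, which the curve never meets. This
plays the role of simple connectivity of the domain. -/
lemma not_mem_curveInside_of_not_mem_zetaDomain {h : ℝ} {γ : ℝ → ℂ}
    (hγ : curveTrace γ ⊆ zetaDomain h) {z : ℂ} (hz : z ∉ zetaDomain h) : z ∉ curveInside γ := by
  have hz' : 0 ≤ z.re ∧ |z.im| = Real.sqrt (h - 1) := not_not.1 hz
  refine not_mem_curveInside_of_ray one_ne_zero fun x hx hm => hγ hm ?_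
  simpa [hz'.2] using add_nonneg hz'.1 hx

lemma IsSimpleClosedCurve.winding_inside {γ : ℝ → ℂ} (h : IsSimpleClosedCurve γ) {z : ℂ}
    (hz : z ∈ curveInside γ) : curveInt γ (fun s => (s - z)⁻¹) = 2 * Real.pi * Complex.I :=
  h.positive z hz

lemma winding_eq_zero_of_not_mem_zetaDomain {h : ℝ} {γ : ℝ → ℂ} (hl : IsLipschitzLoop γ)
    (hγ : curveTrace γ ⊆ zetaDomain h) {z : ℂ} (hz : z ∉ zetaDomain h) :
    curveInt γ (fun s => (s - z)⁻¹) = 0 :=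
  hl.winding_eq_zero (fun hm => hz (hγ hm)) (not_mem_curveInside_of_not_mem_zetaDomain hγ hz)


/-! ### Circles with two dents -/

lemma IsLipschitzLoop.sub_const {γ : ℝ → ℂ} (h : IsLipschitzLoop γ) (p : ℂ) :
    IsLipschitzLoop fun t => γ t - p := by
  obtain ⟨⟨K, hK⟩, hcl⟩ := h
  refine ⟨⟨K, LipschitzOnWith.of_dist_le_mul fun x hx y hy => ?_⟩, by simp only [hcl]⟩
  simpa using hK.dist_le_mul x hx y hy

lemma IsLipschitzLoop.div {α β : ℝ → ℂ} (hα : IsLipschitzLoop α) (hβ : IsLipschitzLoop β)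
    (h0 : ∀ t ∈ Icc (0 : ℝ) 1, β t ≠ 0) : IsLipschitzLoop fun t => α t / β t := by
  obtain ⟨K, hK⟩ := hα.lipschitz
  obtain ⟨K', hK'⟩ := hβ.lipschitz
  obtain ⟨A, hA0, hA⟩ := hα.exists_closedBall
  obtain ⟨B, hB0, hB⟩ := hβ.exists_closedBall
  obtain ⟨C, hC⟩ := isCompact_Icc.exists_bound_of_continuousOn (hβ.continuousOn.inv₀ h0)
  have hC0 : 0 ≤ C := (norm_nonneg _).trans (hC 0 (by simp))
  refine ⟨⟨Real.toNNReal ((K * B + A * K') * C ^ 2), LipschitzOnWith.of_dist_le_mul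
    fun x hx y hy => ?_⟩, by simp only [hα.closed, hβ.closed]⟩
  have h1 := hK.dist_le_mul x hx y hy
  have h2 := hK'.dist_le_mul y hy x hx
  rw [dist_eq_norm] at h1 h2
  rw [dist_comm y x] at h2
  have hx0 := h0 x hx
  have hy0 := h0 y hy
  have heq : α x / β x - α y / β y =
      ((α x - α y) * β y + α y * (β y - β x)) * ((β x)⁻¹ * (β y)⁻¹) := by
    field_simp
    ring
  rw [Real.coe_toNNReal _ (by positivity), dist_eq_norm, heq, norm_mul, norm_mul, sq]
  have h3 : ‖(α x - α y) * β y + α y * (β y - β x)‖ ≤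
      (K * dist x y) * B + A * (K' * dist x y) := by
    refine (norm_add_le _ _).trans ?_
    rw [norm_mul, norm_mul]
    have := hB _ (mem_curveTrace hy)
    have := hA _ (mem_curveTrace hy)
    gcongr
  have h4 : ‖(β x)⁻¹‖ ≤ C := hC x hx
  have h5 : ‖(β y)⁻¹‖ ≤ C := hC y hy
  calc _ ≤ ((K * dist x y) * B + A * (K' * dist x y)) * (C * C) := by gcongr
    _ = _ := by ring

/-- The circle around `0` as a curve on `[0, 1]`. -/
noncomputable def circleLoop (r : ℝ) (t : ℝ) : ℂ := circleMap 0 r (2 * Real.pi * t)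

lemma hasDerivAt_circleLoop (r t : ℝ) :
    HasDerivAt (circleLoop r) (2 * Real.pi * (circleMap 0 r (2 * Real.pi * t) * Complex.I)) t := by
  have h1 : HasDerivAt (fun t : ℝ => 2 * Real.pi * t) (2 * Real.pi) t := by
    simpa using (hasDerivAt_id t).const_mul (2 * Real.pi)
  have := (hasDerivAt_circleMap 0 r (2 * Real.pi * t)).scomp t h1
  rw [Complex.real_smul] at this
  push_cast at this
  exact this

lemma curveInt_circleLoop (r : ℝ) (F : ℂ → ℂ) :
    curveInt (circleLoop r) F = ∮ z in C(0, r), F z := by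
  have h1 := intervalIntegral.smul_integral_comp_mul_left (a := 0) (b := 1)
    (fun θ => deriv (circleMap 0 r) θ • F (circleMap 0 r θ)) (2 * Real.pi)
  rw [mul_zero, mul_one] at h1
  rw [circleIntegral, ← h1, curveInt, ← intervalIntegral.integral_smul]
  refine intervalIntegral.integral_congr fun t _ => ?_
  simp only [(hasDerivAt_circleLoop r t).deriv, deriv_circleMap, circleLoop, smul_eq_mul,
    Complex.real_smul]
  push_cast
  ring

lemma norm_circleLoop {r : ℝ} (hr : 0 ≤ r) (t : ℝ) : ‖circleLoop r t‖ = r := by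
  simp [circleLoop, abs_of_nonneg hr]

lemma isLipschitzLoop_circleLoop (r : ℝ) : IsLipschitzLoop (circleLoop r) := by
  constructor
  · refine ⟨Real.toNNReal (2 * Real.pi * |r|), ?_⟩
    refine (lipschitzWith_of_nnnorm_deriv_le
      (fun t => (hasDerivAt_circleLoop r t).differentiableAt) fun t => ?_).lipschitzOnWith
    rw [(hasDerivAt_circleLoop r t).deriv, ← NNReal.coe_le_coe, Real.coe_toNNReal _ (by positivity)]
    simp [abs_of_pos Real.pi_pos]
  · simp [circleLoop, circleMap]

lemma exists_circleLoop_eq {r : ℝ} (hr : 0 < r) {w : ℂ} (hw : ‖w‖ = r) :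
    ∃ t ∈ Icc (0 : ℝ) 1, circleLoop r t = w := by
  have : w ∈ circleMap 0 r '' Ioc 0 (2 * Real.pi) := by
    rw [image_circleMap_Ioc]
    simp [abs_of_pos hr, hw]
  obtain ⟨θ, hθ, rfl⟩ := this
  have hpi : 0 < 2 * Real.pi := by positivity
  refine ⟨θ / (2 * Real.pi), ⟨div_nonneg hθ.1.le hpi.le, (div_le_one hpi).2 hθ.2⟩, ?_⟩
  simp only [circleLoop]
  congr 1
  field_simp

lemma injOn_circleLoop {r : ℝ} (hr : 0 < r) : InjOn (circleLoop r) (Ico 0 1) := by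
  intro t ht t' ht' h
  have hpi : 0 < 2 * Real.pi := by positivity
  have hI : ∀ x ∈ Ico (0 : ℝ) 1, 2 * Real.pi * x ∈ Ico 0 (2 * Real.pi) := fun x hx =>
    ⟨mul_nonneg hpi.le hx.1, mul_lt_of_lt_one_right hpi hx.2⟩
  exact mul_left_cancel₀ hpi.ne' (injOn_circleMap_of_abs_sub_le' (c := 0) hr.ne'
    (a := 0) (b := 2 * Real.pi) (by simp) (hI t ht) (hI t' ht') h)

lemma winding_circleLoop {r : ℝ} {z : ℂ} (hz : ‖z‖ < r) :
    curveInt (circleLoop r) (fun s => (s - z)⁻¹) = 2 * Real.pi * Complex.I := by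
  rw [curveInt_circleLoop]
  exact circleIntegral.integral_sub_inv_of_mem_ball (by simpa using hz)

/-- The amount by which the points of a circle are moved to the left to keep it off the half-lines
`Re s ≥ 0`, `|Im s| = a`. -/
noncomputable def dent (η N a : ℝ) (w : ℂ) : ℝ :=
  max 0 ((1 + η) * max w.re 0 - N * |(|w.im| - a)|)

/-- A circle with two dents around the half-lines `Re s ≥ 0`, `|Im s| = a`. -/
noncomputable def dentedCircle (r η N a : ℝ) (t : ℝ) : ℂ :=
  circleLoop r t - dent η N a (circleLoop r t)

section

variable {r η N a : ℝ}

lemma dent_nonneg (w : ℂ) : 0 ≤ dent η N a w := le_max_left _ _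

lemma dent_eq_zero (hN : 0 ≤ N) {w : ℂ} (hw : w.re ≤ 0) : dent η N a w = 0 := by
  rw [dent, max_eq_right hw, mul_zero, zero_sub]
  exact max_eq_left (neg_nonpos.2 (by positivity))

lemma dent_le (hη : 0 ≤ η) (hN : 0 ≤ N) {w : ℂ} (hw : 0 ≤ w.re) :
    dent η N a w ≤ (1 + η) * w.re := by
  rw [dent, max_eq_left hw]
  exact max_le (by positivity) (sub_le_self _ (by positivity))

lemma abs_dent_sub_le (hη : 0 ≤ η) (hN : 0 ≤ N) (w w' : ℂ) :
    |dent η N a w - dent η N a w'| ≤ (1 + η + N) * ‖w - w'‖ := by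
  have h1 : |w.re - w'.re| ≤ ‖w - w'‖ := by simpa using Complex.abs_re_le_norm (w - w')
  have h2 : |w.im - w'.im| ≤ ‖w - w'‖ := by simpa using Complex.abs_im_le_norm (w - w')
  have h3 : |max w.re 0 - max w'.re 0| ≤ ‖w - w'‖ := (abs_max_sub_max_le_abs _ _ _).trans h1
  have h4 : |(|(|w.im| - a)| - |(|w'.im| - a)|)| ≤ ‖w - w'‖ := by
    refine (abs_abs_sub_abs_le _ _).trans ?_
    rw [sub_sub_sub_cancel_right]
    exact (abs_abs_sub_abs_le _ _).trans h2
  rw [dent, dent, max_comm 0, max_comm 0]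
  refine (abs_max_sub_max_le_abs _ _ _).trans ?_
  rw [abs_le] at *
  constructor <;> nlinarith

lemma isLipschitzLoop_dentedCircle (hη : 0 ≤ η) (hN : 0 ≤ N) :
    IsLipschitzLoop (dentedCircle r η N a) := by
  obtain ⟨⟨K, hK⟩, hcl⟩ := isLipschitzLoop_circleLoop r
  refine ⟨⟨Real.toNNReal (2 + η + N) * K, ?_⟩, by simp only [dentedCircle, hcl]⟩
  refine LipschitzWith.comp_lipschitzOnWith (f := fun w : ℂ => w - dent η N a w)
    (LipschitzWith.of_dist_le_mul fun w w' => ?_) hK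
  rw [Real.coe_toNNReal _ (by positivity), dist_eq_norm, dist_eq_norm,
    show w - dent η N a w - (w' - dent η N a w') =
      (w - w') - ((dent η N a w - dent η N a w' : ℝ) : ℂ) by push_cast; ring]
  refine (norm_sub_le _ _).trans ?_
  rw [Complex.norm_real, Real.norm_eq_abs]
  linarith [abs_dent_sub_le (a := a) hη hN w w']

lemma mem_curveTrace_dentedCircle (hr : 0 < r) {z : ℂ} :
    z ∈ curveTrace (dentedCircle r η N a) ↔
      ∃ w : ℂ, ‖w‖ = r ∧ z.im = w.im ∧ z.re = w.re - dent η N a w := by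
  constructor
  · rintro ⟨t, -, rfl⟩
    exact ⟨circleLoop r t, norm_circleLoop hr.le t, by simp [dentedCircle], by simp [dentedCircle]⟩
  · rintro ⟨w, hw, h1, h2⟩
    obtain ⟨t, ht, rfl⟩ := exists_circleLoop_eq hr hw
    exact ⟨t, ht, Complex.ext (by simp [dentedCircle, h2]) (by simp [dentedCircle, h1])⟩

lemma re_sq_add_im_sq (w : ℂ) : w.re ^ 2 + w.im ^ 2 = ‖w‖ ^ 2 := by
  rw [Complex.sq_norm, Complex.normSq_apply]; ring

/-- A point with real part `x ≥ 0` moves left by at most `(1 + η) x`, so it ends no further left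
than `-η x`. -/
lemma abs_re_sub_dent_le (hη : 0 ≤ η) (hη1 : η < 1) (hN : 0 ≤ N) (w : ℂ) :
    |w.re - dent η N a w| ≤ |w.re| := by
  rcases le_total w.re 0 with h | h
  · rw [dent_eq_zero hN h, sub_zero]
  · have h1 := dent_le (a := a) hη hN h
    have h2 := dent_nonneg (η := η) (N := N) (a := a) w
    rw [abs_of_nonneg h, abs_le]
    constructor <;> nlinarith

lemma norm_le_of_mem_curveTrace_dentedCircle (hr : 0 < r) (hη : 0 ≤ η) (hη1 : η < 1) (hN : 0 ≤ N)
    {z : ℂ} (hz : z ∈ curveTrace (dentedCircle r η N a)) : ‖z‖ ≤ r := by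
  obtain ⟨w, hw, h1, h2⟩ := (mem_curveTrace_dentedCircle hr).1 hz
  have h3 := re_sq_add_im_sq z
  have h4 := re_sq_add_im_sq w
  have h5 := sq_le_sq.2 (abs_re_sub_dent_le (a := a) hη hη1 hN w)
  rw [h1, h2] at h3
  rw [hw] at h4
  exact abs_le_of_sq_le_sq' (by nlinarith) hr.le |>.2

lemma re_eq_or_of_norm_eq {w w' : ℂ} (h : ‖w‖ = ‖w'‖) (hi : w.im = w'.im) :
    w.re = w'.re ∨ w.re = -w'.re := by
  have h3 := re_sq_add_im_sq w
  have h4 := re_sq_add_im_sq w'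
  rw [h, hi] at h3
  exact sq_eq_sq_iff_eq_or_eq_neg.1 (by linarith)

/-- Denting preserves the imaginary part, so a point can only collide with its mirror image in the
imaginary axis. The latter stays at `-x`, while the dented point stays at or to the right of `-η x`,
with `η < 1`. -/
lemma injOn_dentedCircle (hr : 0 < r) (hη : 0 ≤ η) (hη1 : η < 1) (hN : 0 ≤ N) :
    InjOn (dentedCircle r η N a) (Ico 0 1) := by
  intro t ht t' ht' h
  refine injOn_circleLoop hr ht ht' ?_
  have him : (circleLoop r t).im = (circleLoop r t').im := by
    simpa [dentedCircle] using congrArg Complex.im h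
  have hre : (circleLoop r t).re - dent η N a (circleLoop r t) =
      (circleLoop r t').re - dent η N a (circleLoop r t') := by
    simpa [dentedCircle] using congrArg Complex.re h
  refine Complex.ext ?_ him
  have aux : ∀ w w' : ℂ, w.re = -w'.re → w.re - dent η N a w = w'.re - dent η N a w' →
      0 ≤ w'.re → w.re = w'.re := by
    intro w w' h1 h2 h3
    rw [dent_eq_zero (w := w) hN (by linarith), sub_zero] at h2
    have h4 := dent_le (a := a) hη hN h3
    nlinarith
  rcases re_eq_or_of_norm_eq (by rw [norm_circleLoop hr.le, norm_circleLoop hr.le]) him with h1 | h1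
  · exact h1
  · rcases le_total 0 (circleLoop r t').re with h2 | h2
    · exact aux _ _ h1 hre h2
    · exact (aux _ _ (by linarith) hre.symm (by linarith)).symm

/-- The region bounded by a dented circle. -/
def dentedDisc (r η N a : ℝ) : Set ℂ :=
  {p | ‖p‖ < r ∧ ∀ w : ℂ, ‖w‖ = r → w.im = p.im → 0 ≤ w.re → p.re < w.re - dent η N a w}

lemma abs_re_lt_of_norm_lt {p w : ℂ} (h : ‖p‖ < ‖w‖) (hi : p.im = w.im) : |p.re| < |w.re| := by
  have h3 := re_sq_add_im_sq p
  have h4 := re_sq_add_im_sq w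
  have h5 := pow_lt_pow_left₀ h (norm_nonneg p) two_ne_zero
  rw [hi] at h3
  exact sq_lt_sq.1 (by linarith)

lemma not_mem_curveTrace_of_mem_dentedDisc (hr : 0 < r) (hN : 0 ≤ N) {p : ℂ}
    (hp : p ∈ dentedDisc r η N a) : p ∉ curveTrace (dentedCircle r η N a) := by
  intro h
  obtain ⟨w, hw, h1, h2⟩ := (mem_curveTrace_dentedCircle hr).1 h
  rcases le_total 0 w.re with h3 | h3
  · exact (hp.2 w hw h1.symm h3).ne h2
  · rw [dent_eq_zero hN h3, sub_zero] at h2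
    have := abs_re_lt_of_norm_lt (hp.1.trans_eq hw.symm) h1
    rw [h2] at this
    exact lt_irrefl _ this

/-- The winding number is that of the undented circle: the quotient of the two curves, seen from
`p`, stays in the slit plane, so its logarithm is a closed primitive of the difference of the two
integrands. -/
lemma winding_dentedCircle (hr : 0 < r) (hη : 0 ≤ η) (hN : 0 ≤ N) {p : ℂ}
    (hp : p ∈ dentedDisc r η N a) :
    curveInt (dentedCircle r η N a) (fun s => (s - p)⁻¹) = 2 * Real.pi * Complex.I := by
  have hγ := isLipschitzLoop_dentedCircle (r := r) (a := a) hη hN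
  have hc := isLipschitzLoop_circleLoop r
  have hpt := not_mem_curveTrace_of_mem_dentedDisc hr hN hp
  have hpc : ∀ t, circleLoop r t - p ≠ 0 := fun t h => by
    rw [sub_eq_zero] at h
    have := hp.1
    rw [← h, norm_circleLoop hr.le] at this
    exact lt_irrefl _ this
  have hpc' : p ∉ curveTrace (circleLoop r) := by
    rintro ⟨t, -, h⟩
    exact hpc t (sub_eq_zero.2 h)
  let u : ℝ → ℂ := fun t => (dentedCircle r η N a t - p) / (circleLoop r t - p)
  -- A quotient in `(-∞, 0]` would place `p` on the horizontal segment swept by the dent, which the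
  -- definition of `dentedDisc` excludes.
  have hslit : ∀ t ∈ Icc (0 : ℝ) 1, u t ∈ Complex.slitPlane := by
    intro t ht
    rw [Complex.mem_slitPlane_iff]
    by_contra! hcon
    set w := circleLoop r t with hwdef
    set d := dent η N a w with hddef
    have hd0 : 0 ≤ d := dent_nonneg w
    have hw : ‖w‖ = r := norm_circleLoop hr.le t
    have hu : u t = (((u t).re : ℝ) : ℂ) := Complex.ext (by simp) (by simp [hcon.2])
    have hmul : (((u t).re : ℝ) : ℂ) * (w - p) = w - d - p := by
      rw [← hu]; exact div_mul_cancel₀ _ (hpc t)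
    have him := congrArg Complex.im hmul
    have hre := congrArg Complex.re hmul
    simp only [Complex.mul_im, Complex.mul_re, Complex.ofReal_re, Complex.ofReal_im, zero_mul,
      add_zero, sub_zero, Complex.sub_im, Complex.sub_re] at him hre
    have him2 : w.im = p.im := by nlinarith [hcon.1]
    have hne : w.re - p.re ≠ 0 := fun h0 => hpc t (Complex.ext (by simpa using h0)
      (by simpa [sub_eq_zero] using him2))
    have hlt := abs_re_lt_of_norm_lt (hp.1.trans_eq hw.symm) him2.symm
    have hx : 0 < w.re - p.re := by
      rcases lt_or_gt_of_ne hne with h1 | h1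
      · nlinarith [hcon.1]
      · exact h1
    have hw0 : 0 ≤ w.re := by
      by_contra! h0
      rw [abs_of_neg h0] at hlt
      linarith [neg_abs_le p.re]
    have := hp.2 w hw him2 hw0
    nlinarith [hcon.1]
  have hu : IsLipschitzLoop u :=
    (hγ.sub_const p).div (hc.sub_const p) fun t _ => hpc t
  have h0 : curveInt u (fun s => s⁻¹) = 0 :=
    hu.curveInt_deriv Complex.isOpen_slitPlane (by rintro _ ⟨t, ht, rfl⟩; exact hslit t ht)
      (G := Complex.log) fun z hz => Complex.hasDerivAt_log hz
  have hi1 := hγ.intervalIntegrable (F := fun s => 1 * (s - p)⁻¹)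
    (IsLipschitzLoop.continuousOn_cauchyKernel continuousOn_const hpt)
  have hi2 := hc.intervalIntegrable (F := fun s => 1 * (s - p)⁻¹)
    (IsLipschitzLoop.continuousOn_cauchyKernel continuousOn_const hpc')
  have h1 : curveInt u (fun s => s⁻¹) = curveInt (dentedCircle r η N a) (fun s => (s - p)⁻¹) -
      curveInt (circleLoop r) (fun s => (s - p)⁻¹) := by
    simp only [one_mul] at hi1 hi2
    rw [curveInt, curveInt, curveInt, ← intervalIntegral.integral_sub hi1 hi2]
    refine intervalIntegral.integral_congr_ae (IsLipschitzLoop.ae_uIoc ?_)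
    filter_upwards [hγ.ae_hasDerivAt] with t ht h2
    have h3 := ((ht h2).sub_const p).fun_div ((hasDerivAt_circleLoop r t).sub_const p) (hpc t)
    have h4 : dentedCircle r η N a t - p ≠ 0 := fun h =>
      hpt (sub_eq_zero.1 h ▸ mem_curveTrace (Ioo_subset_Icc_self h2))
    have h5 := hpc t
    rw [h3.deriv, (hasDerivAt_circleLoop r t).deriv]
    simp only [u]
    field_simp
  rw [h0, winding_circleLoop hp.1] at h1
  exact (sub_eq_zero.1 h1.symm)

/-- If `|p| < r`, move right: meeting the curve would put `p` in the dented disc. Otherwise move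
radially. Only `x > 0` is required, since `p` may itself lie on the curve. -/
lemma exists_ray_dentedCircle (hr : 0 < r) (hη : 0 ≤ η) (hη1 : η < 1) (hN : 0 ≤ N) {p : ℂ}
    (hp : p ∉ dentedDisc r η N a) :
    ∃ d : ℂ, d ≠ 0 ∧ ∀ x : ℝ, 0 < x → p + x * d ∉ curveTrace (dentedCircle r η N a) := by
  rcases lt_or_ge ‖p‖ r with h | h
  · refine ⟨1, one_ne_zero, fun x hx hm => hp ⟨h, ?_⟩⟩
    intro w hw hwp hw0
    obtain ⟨w', hw', h1, h2⟩ := (mem_curveTrace_dentedCircle hr).1 hm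
    simp only [mul_one, Complex.add_im, Complex.ofReal_im, add_zero, Complex.add_re,
      Complex.ofReal_re] at h1 h2
    have hlt := abs_re_lt_of_norm_lt (h.trans_eq hw'.symm) h1
    have hw'0 : 0 ≤ w'.re := by
      by_contra! h0
      rw [dent_eq_zero hN h0.le, sub_zero] at h2
      rw [abs_of_neg h0] at hlt
      linarith [neg_abs_le p.re]
    have : w = w' := by
      refine Complex.ext ?_ (hwp.trans h1)
      rcases re_eq_or_of_norm_eq (hw.trans hw'.symm) (hwp.trans h1) with h | h <;> linarith
    rw [this]
    linarith
  · have hp0 : p ≠ 0 := norm_pos_iff.1 (hr.trans_le h)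
    refine ⟨p, hp0, fun x hx hm => ?_⟩
    have h1 := norm_le_of_mem_curveTrace_dentedCircle hr hη hη1 hN hm
    have h2 : p + x * p = ((1 + x : ℝ) : ℂ) * p := by push_cast; ring
    rw [h2, norm_mul, Complex.norm_real, Real.norm_of_nonneg (by linarith)] at h1
    nlinarith

lemma mem_dentedDisc_of_mem_curveInside (hr : 0 < r) (hη : 0 ≤ η) (hη1 : η < 1) (hN : 0 ≤ N)
    {p : ℂ} (hp : p ∈ curveInside (dentedCircle r η N a)) : p ∈ dentedDisc r η N a := by
  by_contra hcon
  obtain ⟨d, hd0, hd⟩ := exists_ray_dentedCircle hr hη hη1 hN hcon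
  refine not_mem_curveInside_of_ray hd0 (fun x hx => ?_) hp
  rcases hx.eq_or_lt with rfl | hx
  · simpa using hp.1
  · exact hd x hx

/-- Outside the curve the winding number is zero, whereas here it is one. -/
lemma mem_curveInside_of_mem_dentedDisc (hr : 0 < r) (hη : 0 ≤ η) (hN : 0 ≤ N)
    {p : ℂ} (hp : p ∈ dentedDisc r η N a) : p ∈ curveInside (dentedCircle r η N a) := by
  by_contra hcon
  have h1 := (isLipschitzLoop_dentedCircle (r := r) (a := a) hη hN).winding_eq_zero
    (not_mem_curveTrace_of_mem_dentedDisc hr hN hp) hcon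
  rw [winding_dentedCircle hr hη hN hp] at h1
  simp [Real.pi_ne_zero] at h1

lemma isSimpleClosedCurve_dentedCircle (hr : 0 < r) (hη : 0 ≤ η) (hη1 : η < 1) (hN : 0 ≤ N) :
    IsSimpleClosedCurve (dentedCircle r η N a) where
  lipschitz := (isLipschitzLoop_dentedCircle hη hN).lipschitz
  closed := (isLipschitzLoop_dentedCircle hη hN).closed
  simple := injOn_dentedCircle hr hη hη1 hN
  positive _ hz := winding_dentedCircle hr hη hN (mem_dentedDisc_of_mem_curveInside hr hη hη1 hN hz)

end

/-- Compact subsets of the plane without the two half-lines are enclosed by simple closed curves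
that stay close to a given disc and whose points are accessible from the exterior. -/
lemma exists_isSimpleClosedCurve_zetaDomain {h : ℝ} {K : Set ℂ} (hK : IsCompact K)
    (hKΩ : K ⊆ zetaDomain h) {r : ℝ} (hr : 0 < r) (hra : r ≠ Real.sqrt (h - 1))
    (hKr : K ⊆ Metric.ball 0 r) :
    ∃ Γ : ℝ → ℂ, IsSimpleClosedCurve Γ ∧ curveTrace Γ ⊆ zetaDomain h ∧
      curveTrace Γ ⊆ Metric.closedBall 0 r ∧ K ⊆ curveInside Γ ∧
      ∀ q ∈ curveTrace Γ, ∃ d : ℂ, d ≠ 0 ∧ ∀ x : ℝ, 0 < x → q + x * d ∉ curveTrace Γ := by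
  set a := Real.sqrt (h - 1) with ha
  -- Compactness keeps `K` at a positive distance from the half-lines, so near the heights `±a` it
  -- lies strictly to the left of `-ε`.
  obtain ⟨ε, hε, hsep⟩ : ∃ ε : ℝ, 0 < ε ∧ ∀ p ∈ K, |(|p.im| - a)| < ε → p.re < -ε := by
    obtain ⟨δ, hδ, hδK⟩ := hK.exists_thickening_subset_open (isOpen_zetaDomain h) hKΩ
    refine ⟨δ / 2, half_pos hδ, fun p hp hpa => ?_⟩
    by_contra! hre
    obtain ⟨b, hb, hpb⟩ : ∃ b : ℝ, |b| = a ∧ |b - p.im| < δ / 2 := by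
      have ha0 : 0 ≤ a := Real.sqrt_nonneg _
      rcases le_total 0 p.im with h0 | h0
      · refine ⟨a, abs_of_nonneg ha0, ?_⟩
        rwa [abs_of_nonneg h0, abs_sub_comm] at hpa
      · refine ⟨-a, by rw [abs_neg, abs_of_nonneg ha0], ?_⟩
        rw [abs_of_nonpos h0] at hpa
        rwa [show -a - p.im = -p.im - a by ring]
    have hq : (⟨max p.re 0, b⟩ : ℂ) ∈ Metric.thickening δ K := by
      rw [Metric.mem_thickening_iff]
      refine ⟨p, hp, ?_⟩
      rw [dist_eq_norm]
      refine (Complex.norm_le_abs_re_add_abs_im _).trans_lt ?_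
      have : |max p.re 0 - p.re| ≤ δ / 2 := by
        rcases le_total 0 p.re with h0 | h0
        · rw [max_eq_left h0, sub_self, abs_zero]; positivity
        · rw [max_eq_right h0, zero_sub, abs_neg, abs_of_nonpos h0]; linarith
      simp only [Complex.sub_re, Complex.sub_im]
      linarith
    exact hδK hq ⟨le_max_right _ _, hb⟩
  -- `η` makes the dent cross the imaginary axis by at most `ε / 2`, short of `K`. `N ε = 2 r` makes
  -- it shallow enough to clear the disc points once the height differs from `±a` by at least `ε`.
  set η := min (1 / 2) (ε / (2 * r)) with hη
  set N := 2 * r / ε with hN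
  have hη0 : 0 < η := lt_min (by norm_num) (by positivity)
  have hη1 : η < 1 := (min_le_left _ _).trans_lt (by norm_num)
  have hηr : η * r ≤ ε / 2 := by
    have : η ≤ ε / (2 * r) := min_le_right _ _
    calc η * r ≤ ε / (2 * r) * r := by gcongr
      _ = ε / 2 := by field_simp
  have hηr2 : η * r ≤ r / 2 := by
    have : η ≤ 1 / 2 := min_le_left _ _
    nlinarith
  have hN0 : 0 < N := by positivity
  have hNε : N * ε = 2 * r := by rw [hN]; field_simp
  refine ⟨dentedCircle r η N a, isSimpleClosedCurve_dentedCircle hr hη0.le hη1 hN0.le, ?_, ?_, ?_, ?_⟩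
  · intro z hz hzΩ
    obtain ⟨w, hw, h1, h2⟩ := (mem_curveTrace_dentedCircle hr).1 hz
    have hza : |w.im| = a := h1 ▸ hzΩ.2
    have hre := hzΩ.1
    rw [h2] at hre
    -- The dent is zero on the imaginary axis; `r ≠ a` keeps the circle off the endpoints of the
    -- half-lines.
    have hw0 : w.re ≠ 0 := by
      intro h0
      have h4 := re_sq_add_im_sq w
      rw [h0, hw, ← sq_abs w.im, hza] at h4
      exact hra ((pow_left_inj₀ hr.le (Real.sqrt_nonneg _) two_ne_zero).1 (by linarith))
    rcases lt_or_gt_of_ne hw0 with h3 | h3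
    · rw [dent_eq_zero hN0.le h3.le] at hre
      linarith
    · have : (1 + η) * w.re ≤ dent η N a w := by
        rw [dent, hza, sub_self, abs_zero, mul_zero, sub_zero, max_eq_left h3.le]
        exact le_max_right _ _
      nlinarith
  · intro z hz
    rw [mem_closedBall_zero_iff]
    exact norm_le_of_mem_curveTrace_dentedCircle hr hη0.le hη1 hN0.le hz
  · intro p hp
    refine mem_curveInside_of_mem_dentedDisc hr hη0.le hN0.le ?_
    have hpr : ‖p‖ < r := by simpa using hKr hp
    refine ⟨hpr, fun w hw hwp hw0 => ?_⟩
    have hlt := abs_re_lt_of_norm_lt (hpr.trans_eq hw.symm) hwp.symm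
    rw [abs_of_nonneg hw0] at hlt
    have hwr : w.re ≤ r := (le_abs_self _).trans ((Complex.abs_re_le_norm w).trans_eq hw)
    rw [lt_sub_iff_add_lt, ← lt_sub_iff_add_lt', dent, max_eq_left hw0, hwp]
    refine max_lt (by linarith [le_abs_self p.re]) ?_
    have hηw : η * w.re ≤ η * r := by gcongr
    rcases lt_or_ge |(|p.im| - a)| ε with h3 | h3
    · have := hsep p hp h3
      have h4 : 0 ≤ N * |(|p.im| - a)| := by positivity
      linarith
    · have h4 : N * ε ≤ N * |(|p.im| - a)| := by gcongr
      linarith [le_abs_self p.re]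
  · intro q hq
    exact exists_ray_dentedCircle hr hη0.le hη1 hN0.le
      fun hd => not_mem_curveTrace_of_mem_dentedDisc hr hN0.le hd hq


/-! ### The Borel transform -/

lemma IsLipschitzLoop.hasSum_curveInt {γ : ℝ → ℂ} (h : IsLipschitzLoop γ) {F : ℕ → ℂ → ℂ}
    {b : ℕ → ℝ} (hb : Summable b) (hF : ∀ n, ContinuousOn (F n) (curveTrace γ))
    (hFb : ∀ n, ∀ s ∈ curveTrace γ, ‖F n s‖ ≤ b n) :
    HasSum (fun n => curveInt γ (F n)) (curveInt γ fun s => ∑' n, F n s) := by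
  obtain ⟨L, hL0, hL⟩ := h.exists_norm_deriv_le
  refine intervalIntegral.hasSum_integral_of_dominated_convergence (fun n _ => b n * L)
    (fun n => h.aestronglyMeasurable (hF n)) (fun n => ae_uIoc (ae_of_all _ fun t ht => ?_))
    (ae_of_all _ fun t _ => hb.mul_right L) (by simp) (IsLipschitzLoop.ae_uIoc (ae_of_all _ fun t ht => ?_))
  · have := hFb n _ (mem_curveTrace (Ioo_subset_Icc_self ht))
    rw [norm_mul]
    exact mul_le_mul this (hL t ht) (norm_nonneg _) ((norm_nonneg _).trans this)
  · exact (Summable.of_norm_bounded hb fun n =>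
      hFb n _ (mem_curveTrace (Ioo_subset_Icc_self ht))).hasSum.mul_right _

lemma IsLipschitzLoop.curveInt_eq_zero_of_differentiable {γ : ℝ → ℂ} (h : IsLipschitzLoop γ)
    {G : ℂ → ℂ} (hG : Differentiable ℂ G) : curveInt γ G = 0 :=
  h.curveInt_eq_zero isOpen_univ (subset_univ _) (fun _ hz => (hz trivial).elim)
    hG.differentiableOn

/-- The exponential transforms of negative powers. -/
lemma IsLipschitzLoop.curveInt_exp_mul_inv_pow {γ : ℝ → ℂ} (h : IsLipschitzLoop γ) {p : ℂ}
    (hp : p ∉ curveTrace γ) (t : ℂ) (n : ℕ) :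
    curveInt γ (fun s => Complex.exp (t * s) * ((s - p)⁻¹) ^ (n + 1)) =
      curveInt γ (fun s => (s - p)⁻¹) * (t ^ n / n.factorial * Complex.exp (t * p)) := by
  have hc : ContinuousOn (fun s => (s - p)⁻¹) (curveTrace γ) := by
    simpa using IsLipschitzLoop.continuousOn_cauchyKernel (F := fun _ => 1) continuousOn_const hp
  have he : ContinuousOn (fun s => Complex.exp (t * s)) (curveTrace γ) := by fun_prop
  induction n with
  | zero =>
    have hd : Differentiable ℂ (fun s : ℂ => Complex.exp (t * s)) := by fun_prop
    have h0 := h.curveInt_eq_zero_of_differentiable (G := dslope (fun s => Complex.exp (t * s)) p)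
      (differentiableOn_univ.1 ((Complex.differentiableOn_dslope univ_mem).2 hd.differentiableOn))
    rw [h.curveInt_dslope_eq he hp, sub_eq_zero] at h0
    simp only [zero_add, pow_one, h0, pow_zero, Nat.factorial_zero, Nat.cast_one, div_one, one_mul]
    rw [mul_comm]
  | succ n ih =>
    -- Integration by parts: the integrand is the derivative of `e^{ts} (s - p)^{-(n+1)}`, which
    -- raises the order of the pole by one.
    have h1 : curveInt γ (fun s => t * (Complex.exp (t * s) * ((s - p)⁻¹) ^ (n + 1)) -
        ((n + 1 : ℕ) : ℂ) * (Complex.exp (t * s) * ((s - p)⁻¹) ^ (n + 2))) = 0 := by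
      refine h.curveInt_deriv (W := {p}ᶜ) isOpen_compl_singleton
        (fun s hs hsp => hp (by rwa [mem_singleton_iff.1 hsp] at hs))
        (G := fun s => Complex.exp (t * s) * ((s - p)⁻¹) ^ (n + 1)) fun s hs => ?_
      have hne : s - p ≠ 0 := sub_ne_zero.2 hs
      have e1 := ((hasDerivAt_const_mul (x := s) t).cexp).fun_mul
        ((((hasDerivAt_id s).sub_const p).fun_inv hne).fun_pow (n + 1))
      refine e1.congr_deriv ?_
      rw [Nat.add_sub_cancel, id, div_eq_mul_inv, ← inv_pow]
      generalize (s - p)⁻¹ = v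
      ring
    rw [h.curveInt_sub (F := fun s => t * (Complex.exp (t * s) * ((s - p)⁻¹) ^ (n + 1)))
      (G := fun s => ((n + 1 : ℕ) : ℂ) * (Complex.exp (t * s) * ((s - p)⁻¹) ^ (n + 2)))
      (continuousOn_const.mul (he.mul (hc.pow _))) (continuousOn_const.mul (he.mul (hc.pow _))),
      curveInt_const_mul, curveInt_const_mul, ih, sub_eq_zero] at h1
    have hne : ((n + 1 : ℕ) : ℂ) ≠ 0 := Nat.cast_ne_zero.2 n.succ_ne_zero
    refine mul_left_cancel₀ hne (h1.symm.trans ?_)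
    have : (n.factorial : ℂ) ≠ 0 := Nat.cast_ne_zero.2 n.factorial_ne_zero
    rw [Nat.factorial_succ, Nat.cast_mul]
    field_simp
    ring

lemma expType_nonneg (φ : ℂ → ℂ) : 0 ≤ expType φ :=
  Real.sInf_nonneg fun _ hx => hx.1.le

lemma expType_le {φ : ℂ → ℂ} {C r : ℝ} (hr : 0 < r)
    (h : ∀ z : ℂ, ‖φ z‖ ≤ C * Real.exp (r * ‖z‖)) : expType φ ≤ r := by
  refine csInf_le ⟨0, fun x hx => hx.1.le⟩ ⟨hr, max C 1, by positivity, fun z => (h z).trans ?_⟩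
  gcongr
  exact le_max_left _ _

/-- Cauchy's estimate on the circle of radius `n`, with `n! ≤ n ^ n`. The rate `e^τ` is crude, but
convergence of the Borel series far out is all that is needed. -/
lemma IsExpTypeEntire.exists_norm_iteratedDeriv_le {φ : ℂ → ℂ} (h : IsExpTypeEntire φ) :
    ∃ C q : ℝ, 0 < q ∧ ∀ n, ‖iteratedDeriv n φ 0‖ ≤ C * q ^ n := by
  obtain ⟨hd, C, τ, hC⟩ := h
  have hC0 : 0 ≤ C := by simpa using (norm_nonneg _).trans (hC 0)
  refine ⟨C, Real.exp τ, Real.exp_pos _, fun n => ?_⟩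
  rcases n.eq_zero_or_pos with rfl | hn
  · simpa using hC 0
  · have hn' : (0 : ℝ) < n := Nat.cast_pos.2 hn
    have h1 := Complex.norm_iteratedDeriv_le_of_forall_mem_sphere_norm_le (c := 0) (f := φ) n hn'
      (C := C * Real.exp (τ * n)) hd.diffContOnCl (fun z hz => by
        rw [mem_sphere_zero_iff_norm] at hz
        simpa [hz] using hC z)
    refine h1.trans ?_
    rw [div_le_iff₀ (by positivity), mul_comm τ, Real.exp_nat_mul]
    have h2 : (n.factorial : ℝ) ≤ (n : ℝ) ^ n := by exact_mod_cast n.factorial_le_pow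
    have h3 : 0 ≤ C * Real.exp τ ^ n := by positivity
    nlinarith

/-- Pólya's representation of a function of exponential type by its Borel transform. -/
lemma IsBorelTransform.curveInt_exp {Ω U : Set ℂ} {φ B : ℂ → ℂ} (hφ : IsExpTypeEntire φ)
    (hB : IsBorelTransform Ω φ B U) {γ : ℝ → ℂ} (hγ : IsSimpleClosedCurve γ)
    (hγU : curveTrace γ ⊆ U) (hUγ : Uᶜ ⊆ curveInside γ) (t : ℂ) :
    curveInt γ (fun s => Complex.exp (t * s) * B s) = 2 * Real.pi * Complex.I * φ t := by
  obtain ⟨C, q, hq, ha⟩ := hφ.exists_norm_iteratedDeriv_le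
  -- Beyond the type `B` equals its series; beyond `q` the series may be integrated term by term.
  set R := max (expType φ + 1) (q + 1) with hR
  have hR1 : expType φ < R := (lt_add_one _).trans_le (le_max_left _ _)
  have hRq : q < R := (lt_add_one _).trans_le (le_max_right _ _)
  have hR0 : 0 < R := hq.trans hRq
  have hc := isLipschitzLoop_circleLoop R
  have hcn : ∀ s ∈ curveTrace (circleLoop R), ‖s‖ = R := by
    rintro _ ⟨t, -, rfl⟩
    exact norm_circleLoop hR0.le t
  have h0c : (0 : ℂ) ∉ curveTrace (circleLoop R) := fun h => by
    have := hcn 0 h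
    rw [norm_zero] at this
    exact hR0.ne this
  rw [curveInt_eq_of_homologous hγ.isLipschitzLoop hc hB.isOpen hγU
    (fun s hs => hB.subset_of_lt (hR1.trans_eq (hcn s hs).symm)) (fun z hz => ?_)
    (G := fun s => Complex.exp (t * s) * B s)
    ((Differentiable.differentiableOn (by fun_prop)).mul hB.differentiableOn)]
  swap
  · rw [hγ.winding_inside (hUγ hz), winding_circleLoop]
    by_contra! hcon
    exact hz (hB.subset_of_lt (hR1.trans_le hcon))
  have hinv : ContinuousOn (fun s : ℂ => (s - 0)⁻¹) (curveTrace (circleLoop R)) := by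
    simpa using IsLipschitzLoop.continuousOn_cauchyKernel (F := fun _ => 1) continuousOn_const h0c
  -- The term of index `n` integrates to `2πi φ^{(n)}(0) t ^ n / n!`, a term of the Taylor series of
  -- `φ`.
  have hsum := hc.hasSum_curveInt
    (F := fun n s => iteratedDeriv n φ 0 * (Complex.exp (t * s) * ((s - 0)⁻¹) ^ (n + 1)))
    (b := fun n => C * (Real.exp (‖t‖ * R) * R⁻¹) * (q / R) ^ n)
    ((summable_geometric_of_lt_one (by positivity) ((div_lt_one hR0).2 hRq)).mul_left _)
    (fun n => continuousOn_const.mul (ContinuousOn.mul (by fun_prop) (hinv.pow _)))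
    (fun n s hs => by
      have h1 : ‖Complex.exp (t * s)‖ ≤ Real.exp (‖t‖ * R) := by
        refine (Complex.norm_exp_le_exp_norm _).trans (Real.exp_le_exp.2 ?_)
        rw [norm_mul, hcn s hs]
      have hC0 : 0 ≤ C := by simpa using (norm_nonneg _).trans (ha 0)
      rw [norm_mul, norm_mul, norm_pow, norm_inv, sub_zero, hcn s hs]
      calc _ ≤ C * q ^ n * (Real.exp (‖t‖ * R) * R⁻¹ ^ (n + 1)) := by
            have := ha n
            gcongr
        _ = _ := by rw [div_pow, pow_succ, inv_pow]; ring)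
  simp only [curveInt_const_mul, hc.curveInt_exp_mul_inv_pow h0c,
    winding_circleLoop (z := 0) (by simpa using hR0), mul_zero, Complex.exp_zero, mul_one] at hsum
  have hT := (Complex.hasSum_taylorSeries_of_entire hφ.1 0 t).mul_left (2 * Real.pi * Complex.I)
  have h2 : (fun n : ℕ => 2 * Real.pi * Complex.I *
      ((n.factorial : ℂ)⁻¹ • (t - 0) ^ n • iteratedDeriv n φ 0)) = fun n : ℕ =>
      iteratedDeriv n φ 0 * (2 * Real.pi * Complex.I * (t ^ n / n.factorial)) := by
    funext n
    simp only [smul_eq_mul, sub_zero]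
    ring
  rw [h2] at hT
  rw [← hsum.unique hT]
  refine curveInt_congr fun s hs => ?_
  rw [hB.eq_series s (hR1.trans_eq (hcn s hs).symm), borelSeries, ← tsum_mul_left]
  refine tsum_congr fun n => ?_
  rw [sub_zero, inv_pow]
  ring

/-- On the curve `|e^{ts}| ≤ e^{r|t|}`. -/
lemma expType_le_of_curveInt {γ : ℝ → ℂ} (hγ : IsLipschitzLoop γ) {F : ℂ → ℂ}
    (hF : ContinuousOn F (curveTrace γ)) {r : ℝ} (hr : 0 < r)
    (hγr : curveTrace γ ⊆ Metric.closedBall 0 r) {g : ℂ → ℂ} {c : ℂ}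
    (hg : ∀ t, c * curveInt γ (fun s => Complex.exp (t * s) * F s) = g t) : expType g ≤ r := by
  obtain ⟨L, hL0, hL⟩ := hγ.exists_norm_curveInt_le
  obtain ⟨M, hM⟩ := hγ.isCompact_curveTrace.exists_bound_of_continuousOn hF
  have hM0 : 0 ≤ M := (norm_nonneg _).trans (hM (γ 0) (mem_curveTrace (by simp)))
  refine expType_le (C := ‖c‖ * (L * M)) hr fun t => ?_
  rw [← hg, norm_mul, mul_assoc, mul_assoc]
  refine mul_le_mul_of_nonneg_left (hL _ _ (by positivity) fun s hs => ?_) (norm_nonneg _)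
  rw [norm_mul, mul_comm M]
  refine mul_le_mul ((Complex.norm_exp_le_exp_norm _).trans (Real.exp_le_exp.2 ?_)) (hM s hs)
    (norm_nonneg _) (Real.exp_nonneg _)
  rw [norm_mul, mul_comm r]
  exact mul_le_mul_of_nonneg_left (mem_closedBall_zero_iff.1 (hγr hs)) (norm_nonneg _)


/-! ### The symbol `ζ(s² + h)` -/

/-- The pole at `1` is simple with residue `1`. The resulting entire function controls the zeros
even near the pole of the symbol. -/
lemma differentiable_update_sub_one_mul_riemannZeta :
    Differentiable ℂ (Function.update (fun s : ℂ => (s - 1) * riemannZeta s) 1 1) := by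
  intro s
  rcases eq_or_ne s 1 with rfl | hs
  · refine (Complex.analyticAt_of_differentiable_on_punctured_nhds_of_continuousAt ?_
      ?_).differentiableAt
    · filter_upwards [self_mem_nhdsWithin] with z hz
      refine DifferentiableAt.congr_of_eventuallyEq
        (((differentiableAt_id).sub_const 1).mul (differentiableAt_riemannZeta hz)) ?_
      filter_upwards [isOpen_compl_singleton.mem_nhds hz] with w hw
      exact Function.update_of_ne hw _ _
    · rw [continuousAt_update_same]
      exact riemannZeta_residue_one
  · refine DifferentiableAt.congr_of_eventuallyEq
      (((differentiableAt_id).sub_const 1).mul (differentiableAt_riemannZeta hs)) ?_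
    filter_upwards [isOpen_compl_singleton.mem_nhds hs] with w hw
    exact Function.update_of_ne hw _ _

/-- `s² = 1 - h` holds only at `±i√(h - 1)`, the endpoints of the removed half-lines. -/
lemma sq_add_ne_one_of_mem_zetaDomain {h : ℝ} (hh : 1 < h) {s : ℂ} (hs : s ∈ zetaDomain h) :
    s ^ 2 + (h : ℂ) ≠ 1 := by
  intro heq
  have hre := congrArg Complex.re heq
  have him := congrArg Complex.im heq
  simp only [sq, Complex.add_re, Complex.mul_re, Complex.ofReal_re, Complex.one_re,
    Complex.add_im, Complex.mul_im, Complex.ofReal_im, Complex.one_im] at hre him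
  have hre0 : s.re = 0 := by
    have : s.re * s.im = 0 := by linarith
    rcases mul_eq_zero.1 this with h0 | h0
    · exact h0
    · rw [h0] at hre
      nlinarith [mul_self_nonneg s.re]
  refine hs ⟨hre0.ge, ?_⟩
  rw [hre0] at hre
  rw [show h - 1 = s.im ^ 2 by linarith, Real.sqrt_sq_eq_abs]

lemma differentiableOn_zetaSymbol {h : ℝ} (hh : 1 < h) :
    DifferentiableOn ℂ (zetaSymbol h) (zetaDomain h) := fun s hs => by
  refine DifferentiableAt.differentiableWithinAt ?_
  exact DifferentiableAt.comp s (differentiableAt_riemannZeta (sq_add_ne_one_of_mem_zetaDomain hh hs))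
    (by fun_prop)

/-- The zeros of `ζ(s² + h)` do not accumulate, not even at the two half-lines. -/
lemma finite_zeroSet_inter_closedBall {h : ℝ} (hh : 1 < h) (R : ℝ) :
    (zeroSet (zetaDomain h) (zetaSymbol h) ∩ Metric.closedBall 0 R).Finite := by
  by_contra hinf
  -- An entire function vanishing at all the zeros. An accumulation point would force `P = 0`, but
  -- at `s = 1` the argument `1 + h` lies where zeta has no zeros.
  let P : ℂ → ℂ := fun s =>
    Function.update (fun s : ℂ => (s - 1) * riemannZeta s) 1 1 (s ^ 2 + (h : ℂ))
  have hP : Differentiable ℂ P :=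
    differentiable_update_sub_one_mul_riemannZeta.comp (by fun_prop)
  have hP0 : ∀ s ∈ zeroSet (zetaDomain h) (zetaSymbol h), P s = 0 := by
    intro s hs
    simp only [P]
    rw [Function.update_of_ne (sq_add_ne_one_of_mem_zetaDomain hh hs.1)]
    have : riemannZeta (s ^ 2 + (h : ℂ)) = 0 := hs.2
    rw [this, mul_zero]
  obtain ⟨z, -, hz⟩ := Set.Infinite.exists_accPt_of_subset_isCompact hinf
    (isCompact_closedBall (0 : ℂ) R) inter_subset_right
  have hfreq : ∃ᶠ w in 𝓝[≠] z, P w = 0 :=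
    (accPt_iff_frequently_nhdsNE.1 hz).mono fun w hw => hP0 w hw.1
  have hzero := (hP.differentiableOn.analyticOnNhd isOpen_univ).eqOn_zero_of_preconnected_of_frequently_eq_zero
    isPreconnected_univ (mem_univ z) hfreq
  have h1 : P 1 = 0 := hzero (mem_univ 1)
  have hne : (1 : ℂ) ^ 2 + (h : ℂ) ≠ 1 := by
    rw [one_pow]
    intro h0
    have := congrArg Complex.re h0
    simp at this
    linarith
  simp only [P] at h1
  rw [Function.update_of_ne hne] at h1
  rcases mul_eq_zero.1 h1 with h2 | h2
  · exact hne (sub_eq_zero.1 h2)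
  · refine riemannZeta_ne_zero_of_one_le_re ?_ h2
    simp
    linarith

lemma isOpen_zetaDomain_diff {h : ℝ} (hh : 1 < h) {T : Set ℂ}
    (hT : T ⊆ zeroSet (zetaDomain h) (zetaSymbol h)) : IsOpen (zetaDomain h \ T) := by
  rw [isOpen_iff_mem_nhds]
  intro z hz
  have hfin : (T ∩ Metric.closedBall 0 (‖z‖ + 1)).Finite :=
    (finite_zeroSet_inter_closedBall hh (‖z‖ + 1)).subset (inter_subset_inter_left _ hT)
  filter_upwards [(isOpen_zetaDomain h).mem_nhds hz.1,
    hfin.isClosed.isOpen_compl.mem_nhds fun hz' => hz.2 hz'.1,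
    Metric.ball_mem_nhds z one_pos] with w h1 h2 h3
  refine ⟨h1, fun hw => h2 ⟨hw, ?_⟩⟩
  rw [Metric.mem_ball, dist_eq_norm] at h3
  rw [mem_closedBall_zero_iff]
  linarith [norm_sub_norm_le w z]

lemma analyticOrderAt_zetaSymbol_ne_top {h : ℝ} (hh : 1 < h) {s : ℂ} (hs : s ∈ zetaDomain h) :
    analyticOrderAt (zetaSymbol h) s ≠ ⊤ := by
  intro htop
  have hd := isOpen_zetaDomain_diff hh
    (T := zeroSet (zetaDomain h) (zetaSymbol h) \ {s}) sdiff_subset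
  have h1 := analyticOrderAt_eq_top.1 htop
  have h2 : ∀ᶠ z in 𝓝 s, z = s := by
    filter_upwards [h1, hd.mem_nhds ⟨hs, fun hs' => hs'.2 rfl⟩] with z hz hz'
    by_contra hne
    exact hz'.2 ⟨⟨hz'.1, hz⟩, hne⟩
  have h3 : ∀ᶠ z in 𝓝[≠] s, False := by
    filter_upwards [h2.filter_mono nhdsWithin_le_nhds, self_mem_nhdsWithin] with z h4 h5
    exact h5 h4
  exact (eventually_const.1 h3)

/-! ### Principal parts -/

/-- The Borel transform `∑ p_j j! / (z - a)^{j+1}` of the exponential polynomial `p(t) e^{at}`. -/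
noncomputable def principalPart (p : Polynomial ℂ) (a z : ℂ) : ℂ :=
  p.sum fun j c => c * j.factorial * ((z - a)⁻¹) ^ (j + 1)

lemma differentiableAt_principalPart (p : Polynomial ℂ) {a z : ℂ} (hz : z ≠ a) :
    DifferentiableAt ℂ (principalPart p a) z := by
  have hd : DifferentiableAt ℂ (fun z => (z - a)⁻¹) z :=
    (differentiableAt_id.sub_const a).inv (sub_ne_zero.2 hz)
  unfold principalPart Polynomial.sum
  exact DifferentiableAt.fun_sum fun j _ => (differentiableAt_const _).mul (hd.pow _)

lemma IsLipschitzLoop.curveInt_exp_mul_principalPart {γ : ℝ → ℂ} (h : IsLipschitzLoop γ)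
    (p : Polynomial ℂ) {a : ℂ} (ha : a ∉ curveTrace γ) (t : ℂ) :
    curveInt γ (fun s => Complex.exp (t * s) * principalPart p a s) =
      curveInt γ (fun s => (s - a)⁻¹) * (p.eval t * Complex.exp (t * a)) := by
  have hc : ContinuousOn (fun s => (s - a)⁻¹) (curveTrace γ) := by
    simpa using IsLipschitzLoop.continuousOn_cauchyKernel (F := fun _ => 1) continuousOn_const ha
  have h1 : (fun s => Complex.exp (t * s) * principalPart p a s) = fun s => ∑ j ∈ p.support,
      p.coeff j * j.factorial * (Complex.exp (t * s) * ((s - a)⁻¹) ^ (j + 1)) := by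
    funext s
    rw [principalPart, Polynomial.sum, Finset.mul_sum]
    exact Finset.sum_congr rfl fun j _ => by ring
  rw [h1, h.curveInt_finset_sum (F := fun j s =>
    p.coeff j * j.factorial * (Complex.exp (t * s) * ((s - a)⁻¹) ^ (j + 1))) _ fun j _ =>
    continuousOn_const.mul (ContinuousOn.mul (by fun_prop) (hc.pow _))]
  simp only [curveInt_const_mul, h.curveInt_exp_mul_inv_pow ha]
  rw [Polynomial.eval_eq_sum, Polynomial.sum, Finset.sum_mul, Finset.mul_sum]
  refine Finset.sum_congr rfl fun j _ => ?_
  have : (j.factorial : ℂ) ≠ 0 := Nat.cast_ne_zero.2 j.factorial_ne_zero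
  field_simp

/-- The degree bound gives pole order `j + 1 ≤ m` in every term. -/
lemma exists_analyticAt_pow_mul_principalPart {p : Polynomial ℂ} {m : ℕ} (hp : p.degree < m)
    (a : ℂ) : ∃ q : ℂ → ℂ, AnalyticAt ℂ q a ∧ ∀ z ≠ a, (z - a) ^ m * principalPart p a z = q z := by
  refine ⟨fun z => ∑ j ∈ p.support, p.coeff j * j.factorial * (z - a) ^ (m - (j + 1)), ?_, ?_⟩
  · fun_prop
  · intro z hz
    rw [principalPart, Polynomial.sum, Finset.mul_sum]
    refine Finset.sum_congr rfl fun j hj => ?_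
    have hjm : j + 1 ≤ m := by
      have := (Polynomial.le_degree_of_mem_supp j hj).trans_lt hp
      exact_mod_cast this
    have hne : z - a ≠ 0 := sub_ne_zero.2 hz
    obtain ⟨k, rfl⟩ := Nat.exists_eq_add_of_le hjm
    rw [Nat.add_sub_cancel_left, pow_add, inv_pow]
    field_simp

/-- Splitting `w` as `w(a) + (z - a) dslope w a z` lowers the exponent by one; the leading term is
the transform of the monomial `w(a) t ^ m / m!`. -/
lemma exists_principalPart_pow (a : ℂ) (m : ℕ) :
    ∀ {w : ℂ → ℂ}, AnalyticAt ℂ w a → ∃ p : Polynomial ℂ, p.degree < m ∧ ∃ v : ℂ → ℂ,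
      AnalyticAt ℂ v a ∧ ∀ z ≠ a, w z * ((z - a)⁻¹) ^ m = principalPart p a z + v z := by
  induction m with
  | zero => exact fun {w} hw => ⟨0, by simp, w, hw, fun z _ => by simp [principalPart]⟩
  | succ m ih =>
    intro w hw
    have hds : AnalyticAt ℂ (dslope w a) a := by
      obtain ⟨s, hs, hws⟩ := hw.exists_mem_nhds_analyticOnNhd
      exact ((Complex.differentiableOn_dslope hs).2 hws.differentiableOn).analyticAt hs
    obtain ⟨p, hp, v, hv, hpv⟩ := ih hds
    refine ⟨p + Polynomial.monomial m (w a / m.factorial), ?_, v, hv, fun z hz => ?_⟩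
    · refine (Polynomial.degree_add_le _ _).trans_lt (max_lt ?_ ?_)
      · exact hp.trans (by exact_mod_cast m.lt_succ_self)
      · exact (Polynomial.degree_monomial_le _ _).trans_lt (by exact_mod_cast m.lt_succ_self)
    · have hne : z - a ≠ 0 := sub_ne_zero.2 hz
      have hm : (m.factorial : ℂ) ≠ 0 := Nat.cast_ne_zero.2 m.factorial_ne_zero
      have h1 : principalPart (p + Polynomial.monomial m (w a / m.factorial)) a z =
          principalPart p a z + w a * ((z - a)⁻¹) ^ (m + 1) := by
        rw [principalPart, Polynomial.sum_add_index _ _ _ (by simp) (by intros; ring),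
          Polynomial.sum_monomial_index _ _ (by simp), div_mul_cancel₀ _ hm, principalPart]
      rw [h1, add_right_comm, ← hpv z hz, dslope_of_ne _ hz, slope_def_field, pow_succ]
      field_simp
      ring

/-- The principal part of a quotient at a zero of the denominator. -/
lemma exists_principalPart_div {u f : ℂ → ℂ} {a : ℂ} (hu : AnalyticAt ℂ u a)
    (hf : AnalyticAt ℂ f a) (hf' : analyticOrderAt f a ≠ ⊤) :
    ∃ p : Polynomial ℂ, p.degree < (analyticOrderNatAt f a : WithBot ℕ) ∧ ∃ v : ℂ → ℂ,
      AnalyticAt ℂ v a ∧ ∀ᶠ z in 𝓝[≠] a, (f z)⁻¹ * u z = principalPart p a z + v z := by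
  obtain ⟨f₁, hf₁, hne, heq⟩ := (hf.analyticOrderAt_ne_top).1 hf'
  obtain ⟨p, hp, v, hv, hpv⟩ := exists_principalPart_pow a (analyticOrderNatAt f a)
    (hu.div hf₁ hne)
  refine ⟨p, hp, v, hv, ?_⟩
  filter_upwards [heq.filter_mono nhdsWithin_le_nhds, self_mem_nhdsWithin] with z h1 h2
  rw [← hpv z h2, h1, smul_eq_mul, inv_pow, mul_inv, Pi.div_apply]
  ring

lemma exists_differentiableOn_of_removable {W : Set ℂ} (S : Finset ℂ)
    {G : ℂ → ℂ} (hG : ∀ z ∈ W, z ∉ S → DifferentiableAt ℂ G z)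
    (hS : ∀ a ∈ S, ∃ v : ℂ → ℂ, AnalyticAt ℂ v a ∧ ∀ᶠ z in 𝓝[≠] a, G z = v z) :
    ∃ H : ℂ → ℂ, DifferentiableOn ℂ H W ∧ ∀ z ∉ S, G z = H z := by
  classical
  choose! v hv hGv using hS
  refine ⟨fun z => if z ∈ S then v z z else G z, fun z hz => ?_, fun z hz => by simp [hz]⟩
  refine DifferentiableAt.differentiableWithinAt ?_
  by_cases hzS : z ∈ S
  · refine (hv z hzS).differentiableAt.congr_of_eventuallyEq ?_
    have h1 : ∀ᶠ w in 𝓝 z, w ∉ S.erase z :=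
      (S.erase z).finite_toSet.isClosed.isOpen_compl.mem_nhds (by simp)
    filter_upwards [h1, eventually_nhdsWithin_iff.1 (hGv z hzS)] with w h2 h3
    rcases eq_or_ne w z with rfl | hne
    · simp [hzS]
    · have : w ∉ S := fun h => h2 (Finset.mem_erase.2 ⟨hne, h⟩)
      simp only [if_neg this, h3 hne]
  · refine (hG z hz hzS).congr_of_eventuallyEq ?_
    have h1 : ∀ᶠ w in 𝓝 z, w ∉ S := S.finite_toSet.isClosed.isOpen_compl.mem_nhds hzS
    filter_upwards [h1] with w hw
    simp only [if_neg hw]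

/-- A function with finitely many poles is the sum of its principal parts and a holomorphic
function. -/
lemma exists_principalPart_decomposition {W : Set ℂ} (S : Finset ℂ) {m : ℂ → ℕ}
    {G : ℂ → ℂ} (hG : ∀ z ∈ W, z ∉ S → DifferentiableAt ℂ G z)
    (hS : ∀ a ∈ S, ∃ p : Polynomial ℂ, p.degree < (m a : WithBot ℕ) ∧ ∃ v : ℂ → ℂ,
      AnalyticAt ℂ v a ∧ ∀ᶠ z in 𝓝[≠] a, G z = principalPart p a z + v z) :
    ∃ p : ℂ → Polynomial ℂ, (∀ a ∈ S, (p a).degree < (m a : WithBot ℕ)) ∧ ∃ H : ℂ → ℂ,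
      DifferentiableOn ℂ H W ∧ ∀ z ∉ S, G z = H z + ∑ a ∈ S, principalPart (p a) a z := by
  classical
  choose! p hp v hv hpv using hS
  -- The principal parts at the other points are analytic at `a`, so subtracting all of them leaves
  -- removable singularities.
  have hloc : ∀ a ∈ S, ∃ w : ℂ → ℂ, AnalyticAt ℂ w a ∧
      ∀ᶠ z in 𝓝[≠] a, G z - ∑ b ∈ S, principalPart (p b) b z = w z := by
    intro a ha
    refine ⟨fun z => v a z - ∑ b ∈ S.erase a, principalPart (p b) b z, ?_, ?_⟩
    · refine (hv a ha).sub (Finset.analyticAt_fun_sum _ fun b hb => ?_)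
      rw [Complex.analyticAt_iff_eventually_differentiableAt]
      filter_upwards [isOpen_compl_singleton.mem_nhds (Finset.ne_of_mem_erase hb).symm] with z hz
      exact differentiableAt_principalPart _ hz
    · filter_upwards [hpv a ha] with z hz
      rw [hz, ← Finset.add_sum_erase S _ ha]
      ring
  obtain ⟨H, hH, hGH⟩ := exists_differentiableOn_of_removable (W := W) S
    (fun z hz hzS => (hG z hz hzS).fun_sub (DifferentiableAt.fun_sum fun a ha =>
      differentiableAt_principalPart _ (by rintro rfl; exact hzS ha))) hloc
  exact ⟨p, hp, H, hH, fun z hz => by rw [← hGH z hz]; ring⟩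

/-! ### Annihilated functions extend to the inside of the curve -/

lemma IsLipschitzLoop.isOpen_curveInside {γ : ℝ → ℂ} (h : IsLipschitzLoop γ) :
    IsOpen (curveInside γ) := by
  rw [isOpen_iff_mem_nhds]
  intro z hz
  filter_upwards [h.isOpen_compl_curveTrace.connectedComponentIn.mem_nhds
    (mem_connectedComponentIn hz.1)] with w hw
  exact ⟨connectedComponentIn_subset _ _ hw, by rw [← connectedComponentIn_eq hw]; exact hz.2⟩

/-- A function that is holomorphic near the curve and whose exponential transform vanishes extends
holomorphically to the inside, and so is annihilated by the holomorphic functions there. -/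
lemma exists_extension_of_curveInt_exp_eq_zero {γ : ℝ → ℂ} (hγ : IsSimpleClosedCurve γ)
    (hext : ∀ q ∈ curveTrace γ, ∃ d : ℂ, d ≠ 0 ∧ ∀ x : ℝ, 0 < x → q + x * d ∉ curveTrace γ)
    {N : Set ℂ} (hN : IsOpen N) (hγN : curveTrace γ ⊆ N) {F : ℂ → ℂ}
    (hF : DifferentiableOn ℂ F N)
    (h0 : ∀ t : ℂ, curveInt γ (fun s => Complex.exp (t * s) * F s) = 0) :
    ∃ (W : Set ℂ) (E : ℂ → ℂ), IsOpen W ∧ curveTrace γ ⊆ W ∧ curveInside γ ⊆ W ∧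
      DifferentiableOn ℂ E W ∧ ∀ z ∈ curveTrace γ, E z = F z := by
  classical
  have hl := hγ.isLipschitzLoop
  have hFc := hF.continuousOn.mono hγN
  let J : ℂ → ℂ := fun z => curveInt γ (dslope F z)
  have hJd : DifferentiableOn ℂ J N := fun z hz =>
    (hl.differentiableAt_curveInt_dslope hN hγN hF hz).differentiableWithinAt
  -- `J` is holomorphic across the curve and vanishes along an exterior ray ending at `q`, where
  -- both the Cauchy integral and the winding number are zero. By the identity theorem it vanishes
  -- near `q`.
  have hJ : ∀ q ∈ curveTrace γ, ∀ᶠ z in 𝓝 q, J z = 0 := by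
    intro q hq
    obtain ⟨d, hd0, hd⟩ := hext q hq
    refine ((hJd.analyticAt (hN.mem_nhds (hγN hq))).frequently_zero_iff_eventually_zero).1 ?_
    have ht : Tendsto (fun x : ℝ => q + x * d) (𝓝[>] 0) (𝓝[≠] q) := by
      rw [tendsto_nhdsWithin_iff]
      constructor
      · have hc : Continuous fun x : ℝ => q + x * d := by fun_prop
        have := hc.tendsto 0
        simp only [Complex.ofReal_zero, zero_mul, add_zero] at this
        exact this.mono_left nhdsWithin_le_nhds
      · filter_upwards [self_mem_nhdsWithin] with x hx
        have : (x : ℂ) ≠ 0 := Complex.ofReal_ne_zero.2 (ne_of_gt hx)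
        simp [this, hd0]
    refine ht.frequently (Eventually.frequently ?_)
    filter_upwards [self_mem_nhdsWithin] with x hx
    have hx0 : 0 < x := hx
    have hz := hd x hx0
    have hz' : q + x * d ∉ curveInside γ := by
      refine not_mem_curveInside_of_ray hd0 fun y hy => ?_
      have := hd (x + y) (by linarith)
      rwa [Complex.ofReal_add, add_mul, ← add_assoc] at this
    simp only [J]
    rw [hl.curveInt_dslope_eq hFc hz, hl.winding_eq_zero hz hz',
      hl.cauchyIntegral_eq_zero_of_moments hFc (hl.moments_eq_zero hFc h0) hz hz']
    simp
  let N₀ : Set ℂ := {z | z ∈ N ∧ ∀ᶠ w in 𝓝 z, J w = 0}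
  have hN₀ : IsOpen N₀ := by
    rw [isOpen_iff_mem_nhds]
    intro z hz
    filter_upwards [hN.mem_nhds hz.1, eventually_eventually_nhds.2 hz.2] with w h1 h2
    exact ⟨h1, h2⟩
  -- Just inside the curve `J = 0` says that the normalised Cauchy integral equals `F`, so the two
  -- pieces glue.
  let E : ℂ → ℂ := fun z => if z ∈ curveInside γ then
    (2 * Real.pi * Complex.I)⁻¹ * curveInt γ (fun s => F s * (s - z)⁻¹) else F z
  refine ⟨curveInside γ ∪ N₀, E, hl.isOpen_curveInside.union hN₀,
    fun q hq => Or.inr ⟨hγN hq, hJ q hq⟩, subset_union_left, ?_, ?_⟩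
  · rintro z (hz | hz)
    · refine DifferentiableAt.differentiableWithinAt (DifferentiableAt.congr_of_eventuallyEq
        ((hl.differentiableAt_cauchyIntegral hFc hz.1).const_mul (2 * Real.pi * Complex.I)⁻¹) ?_)
      filter_upwards [hl.isOpen_curveInside.mem_nhds hz] with w hw
      simp only [E, if_pos hw]
    · refine DifferentiableAt.differentiableWithinAt (DifferentiableAt.congr_of_eventuallyEq
        (hF.differentiableAt (hN.mem_nhds hz.1)) ?_)
      filter_upwards [hz.2] with w h2
      by_cases hw : w ∈ curveInside γ
      · simp only [J] at h2
        rw [hl.curveInt_dslope_eq hFc hw.1, hγ.winding_inside hw, sub_eq_zero] at h2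
        simp only [E, if_pos hw, h2]
        rw [mul_comm (F w), inv_mul_cancel_left₀ Complex.two_pi_I_ne_zero]
      · simp only [E, if_neg hw]
  · intro z hz
    have : z ∉ curveInside γ := fun h => h.1 hz
    simp only [E, if_neg this]


/-! ### The equation `ζ(∂² + h) φ = g` -/

lemma IsBorelTransform.compl_subset_closedBall {Ω U : Set ℂ} {φ B : ℂ → ℂ}
    (h : IsBorelTransform Ω φ B U) : Uᶜ ⊆ Metric.closedBall 0 (expType φ) := by
  intro z hz
  rw [mem_closedBall_zero_iff]
  by_contra! hcon
  exact hz (h.subset_of_lt hcon)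

lemma IsBorelTransform.isCompact_compl {Ω U : Set ℂ} {φ B : ℂ → ℂ}
    (h : IsBorelTransform Ω φ B U) : IsCompact Uᶜ :=
  (isCompact_closedBall _ _).of_isClosed_subset h.isOpen.isClosed_compl h.compl_subset_closedBall

lemma curveTrace_subset_of_mem_HOne {Ω U : Set ℂ} {γ : ℝ → ℂ} (h : γ ∈ HOne Ω U) :
    curveTrace γ ⊆ U := fun z hz => by
  by_contra hcon
  exact (h.2.2 hcon).1 hz

/-- Curves in `H₁` that enclose the same poles are homologous. -/
lemma curveInt_eq_of_mem_HOne {h : ℝ} (hh : 1 < h) {U T : Set ℂ} (hU : IsOpen U)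
    (hT : T ⊆ zeroSet (zetaDomain h) (zetaSymbol h)) {γ₁ γ₂ : ℝ → ℂ}
    (h₁ : γ₁ ∈ HOne (zetaDomain h) U) (h₂ : γ₂ ∈ HOne (zetaDomain h) U)
    (hT₁ : Disjoint (curveTrace γ₁) T) (hT₂ : Disjoint (curveTrace γ₂) T)
    (hi : ∀ s ∈ T, s ∈ curveInside γ₁ ↔ s ∈ curveInside γ₂) {G : ℂ → ℂ}
    (hG : DifferentiableOn ℂ G (U ∩ (zetaDomain h \ T))) : curveInt γ₁ G = curveInt γ₂ G := by
  have l₁ := h₁.1.isLipschitzLoop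
  have l₂ := h₂.1.isLipschitzLoop
  refine curveInt_eq_of_homologous l₁ l₂ (hU.inter (isOpen_zetaDomain_diff hh hT))
    (fun z hz => ⟨curveTrace_subset_of_mem_HOne h₁ hz, h₁.2.1 hz, disjoint_left.1 hT₁ hz⟩)
    (fun z hz => ⟨curveTrace_subset_of_mem_HOne h₂ hz, h₂.2.1 hz, disjoint_left.1 hT₂ hz⟩)
    (fun z hz => ?_) hG
  -- A point may be missing from the domain in three ways: outside `U` both curves wind once,
  -- outside `Ω` neither winds, and on `T` the winding numbers agree by `hi`.
  by_cases hzU : z ∈ U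
  · by_cases hzΩ : z ∈ zetaDomain h
    · have hzT : z ∈ T := by
        by_contra hzT
        exact hz ⟨hzU, hzΩ, hzT⟩
      by_cases hzi : z ∈ curveInside γ₁
      · rw [h₁.1.winding_inside hzi, h₂.1.winding_inside ((hi z hzT).1 hzi)]
      · rw [l₁.winding_eq_zero (disjoint_right.1 hT₁ hzT) hzi,
          l₂.winding_eq_zero (disjoint_right.1 hT₂ hzT) fun h0 => hzi ((hi z hzT).2 h0)]
    · rw [winding_eq_zero_of_not_mem_zetaDomain l₁ h₁.2.1 hzΩ,
        winding_eq_zero_of_not_mem_zetaDomain l₂ h₂.2.1 hzΩ]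
  · rw [h₁.1.winding_inside (h₁.2.2 hzU), h₂.1.winding_inside (h₂.2.2 hzU)]

/-- A compact subset of the disc of radius `τ` is enclosed by a curve that stays close to this disc
and encloses exactly the zeros of `ζ(s² + h)` in it. -/
lemma exists_curve_enclosing_zeros {h : ℝ} (hh : 1 < h) {K : Set ℂ} (hK : IsCompact K)
    (hKΩ : K ⊆ zetaDomain h) {τ r₀ : ℝ} (hτ : 0 ≤ τ) (hr₀ : τ < r₀)
    (hKτ : K ⊆ Metric.closedBall 0 τ) :
    ∃ Γ : ℝ → ℂ, IsSimpleClosedCurve Γ ∧ curveTrace Γ ⊆ zetaDomain h ∧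
      curveTrace Γ ⊆ Metric.closedBall 0 r₀ ∧ K ⊆ curveInside Γ ∧
      (∀ q ∈ curveTrace Γ, ∃ d : ℂ, d ≠ 0 ∧ ∀ x : ℝ, 0 < x → q + x * d ∉ curveTrace Γ) ∧
      Disjoint (curveTrace Γ) (zeroSet (zetaDomain h) (zetaSymbol h)) ∧
      ∀ s ∈ zeroSet (zetaDomain h) (zetaSymbol h), s ∈ curveInside Γ ↔ ‖s‖ ≤ τ := by
  set Z := zeroSet (zetaDomain h) (zetaSymbol h) with hZ
  -- Finitely many zeros lie in the larger disc, so a radius slightly above `τ` admits no new ones.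
  have hev : ∀ᶠ r in 𝓝[>] τ, ∀ s ∈ Z ∩ Metric.closedBall 0 r₀, ‖s‖ ≤ τ ∨ r < ‖s‖ := by
    rw [eventually_all_finite (finite_zeroSet_inter_closedBall hh r₀)]
    intro s _
    rcases le_or_gt ‖s‖ τ with h1 | h1
    · exact Eventually.of_forall fun _ => Or.inl h1
    · filter_upwards [Ioo_mem_nhdsGT h1] with r hr
      exact Or.inr hr.2
  have hev2 : ∀ᶠ r in 𝓝[>] τ, r ≠ Real.sqrt (h - 1) := by
    rcases le_or_gt (Real.sqrt (h - 1)) τ with h1 | h1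
    · filter_upwards [self_mem_nhdsWithin] with r hr
      exact (h1.trans_lt hr).ne'
    · filter_upwards [Ioo_mem_nhdsGT h1] with r hr
      exact hr.2.ne
  obtain ⟨r, hr1, hr2, hτr, hrr₀⟩ :=
    (hev.and (hev2.and (Ioo_mem_nhdsGT hr₀))).exists
  have hzr : ∀ s ∈ Z, ‖s‖ ≤ r → ‖s‖ ≤ τ := fun s hs hsr =>
    (hr1 s ⟨hs, mem_closedBall_zero_iff.2 (hsr.trans hrr₀.le)⟩).resolve_right hsr.not_gt
  -- The zeros are enclosed along with `K`, so that no dent cuts them off.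
  obtain ⟨Γ, hΓ, hΓΩ, hΓr, hin, hext⟩ := exists_isSimpleClosedCurve_zetaDomain
    (hK.union (finite_zeroSet_inter_closedBall hh τ).isCompact)
    (union_subset hKΩ fun s hs => hs.1.1) (hτ.trans_lt hτr) hr2
    ((union_subset hKτ inter_subset_right).trans (Metric.closedBall_subset_ball hτr))
  have hzin : ∀ s ∈ Z, ‖s‖ ≤ τ → s ∈ curveInside Γ := fun s hs hsτ =>
    hin (Or.inr ⟨hs, mem_closedBall_zero_iff.2 hsτ⟩)
  refine ⟨Γ, hΓ, hΓΩ, hΓr.trans (Metric.closedBall_subset_closedBall hrr₀.le),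
    subset_union_left.trans hin, hext, disjoint_left.2 fun s hs hsZ => ?_, fun s hs => ⟨fun hsi => ?_,
    hzin s hs⟩⟩
  · exact (hzin s hsZ (hzr s hsZ (mem_closedBall_zero_iff.1 (hΓr hs)))).1 hs
  · refine hzr s hs (mem_closedBall_zero_iff.1 (IsLipschitzLoop.curveInside_subset_closedBall (fun w hw => ?_) hsi))
    exact mem_closedBall_zero_iff.1 (hΓr hw)

lemma differentiableOn_exp_mul {W : Set ℂ} {G : ℂ → ℂ} (hG : DifferentiableOn ℂ G W) (t : ℂ) :
    DifferentiableOn ℂ (fun s => Complex.exp (t * s) * G s) W :=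
  (Differentiable.differentiableOn (by fun_prop)).mul hG

lemma continuousOn_exp_mul {W : Set ℂ} {G : ℂ → ℂ} (hG : ContinuousOn G W) (t : ℂ) :
    ContinuousOn (fun s => Complex.exp (t * s) * G s) W :=
  ContinuousOn.mul (by fun_prop) hG

/-- The curve in the equation can be moved into the disc of any radius `r > τ_φ`. -/
lemma expType_le_of_solves {h : ℝ} (hh : 1 < h) {φ g : ℂ → ℂ}
    (hs : SolvesSymbolEquation (zetaDomain h) (zetaSymbol h) φ g) : expType g ≤ expType φ := by
  obtain ⟨B, U, γ, hB, hγ, hsol⟩ := hs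
  refine le_of_forall_gt_imp_ge_of_dense fun r hr => ?_
  obtain ⟨Γ, hΓ, hΓΩ, hΓr, hin, -⟩ := exists_curve_enclosing_zeros hh hB.isCompact_compl
    (compl_subset_comm.1 hB.compl_subset) (expType_nonneg φ) hr hB.compl_subset_closedBall
  have hΓ1 : Γ ∈ HOne (zetaDomain h) U := ⟨hΓ, hΓΩ, hin⟩
  have hfB : DifferentiableOn ℂ (fun s => zetaSymbol h s * B s) (U ∩ zetaDomain h) :=
    ((differentiableOn_zetaSymbol hh).mono inter_subset_right).mul
      (hB.differentiableOn.mono inter_subset_left)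
  refine expType_le_of_curveInt (F := fun s => zetaSymbol h s * B s)
    (c := (2 * Real.pi * Complex.I)⁻¹) hΓ.isLipschitzLoop
    (hfB.continuousOn.mono fun z hz => ⟨curveTrace_subset_of_mem_HOne hΓ1 hz, hΓΩ hz⟩)
    ((expType_nonneg φ).trans_lt hr) hΓr fun t => ?_
  rw [← hsol t, pTransform, curveInt_eq_of_mem_HOne hh hB.isOpen (empty_subset _) hΓ1 hγ (by simp)
    (by simp) (by simp) (by simpa using differentiableOn_exp_mul hfB t)]
  simp only [mul_assoc]

lemma differentiableAt_inv_zetaSymbol {h : ℝ} (hh : 1 < h) {z : ℂ} (hz : z ∈ zetaDomain h)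
    (hz0 : z ∉ zeroSet (zetaDomain h) (zetaSymbol h)) :
    DifferentiableAt ℂ (fun s => (zetaSymbol h s)⁻¹) z :=
  ((differentiableOn_zetaSymbol hh).differentiableAt ((isOpen_zetaDomain h).mem_nhds hz)).inv
    fun h0 => hz0 ⟨hz, h0⟩

/-- The zero of the symbol cancels the pole, so the integrand extends to all of `Ω` and Cauchy's
theorem applies. In effect, `p(t) e^{at}` solves the homogeneous equation. -/
lemma curveInt_zetaSymbol_mul_principalPart {h : ℝ} (hh : 1 < h) {γ : ℝ → ℂ}
    (hγ : IsLipschitzLoop γ) (hγΩ : curveTrace γ ⊆ zetaDomain h) {a : ℂ} (ha : a ∈ zetaDomain h)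
    (haγ : a ∉ curveTrace γ) {p : Polynomial ℂ}
    (hp : p.degree < (analyticOrderNatAt (zetaSymbol h) a : WithBot ℕ)) (t : ℂ) :
    curveInt γ (fun s => Complex.exp (t * s) * (zetaSymbol h s * principalPart p a s)) = 0 := by
  have hf := differentiableOn_zetaSymbol hh
  have hfa := hf.analyticAt ((isOpen_zetaDomain h).mem_nhds ha)
  obtain ⟨f₁, hf₁, -, heq⟩ :=
    (hfa.analyticOrderAt_ne_top).1 (analyticOrderAt_zetaSymbol_ne_top hh ha)
  obtain ⟨q, hq, hpq⟩ := exists_analyticAt_pow_mul_principalPart hp a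
  obtain ⟨H, hH, hGH⟩ := exists_differentiableOn_of_removable (W := zetaDomain h) {a}
    (G := fun s => Complex.exp (t * s) * (zetaSymbol h s * principalPart p a s))
    (fun z hz hza => DifferentiableAt.mul (by fun_prop)
      ((hf.differentiableAt ((isOpen_zetaDomain h).mem_nhds hz)).mul
        (differentiableAt_principalPart p (by simpa using hza)))) (by
    intro b hb
    rw [Finset.mem_singleton] at hb
    subst hb
    refine ⟨fun s => Complex.exp (t * s) * (f₁ s * q s), by fun_prop, ?_⟩
    filter_upwards [heq.filter_mono nhdsWithin_le_nhds, self_mem_nhdsWithin] with z h1 h2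
    rw [h1, ← hpq z h2, smul_eq_mul]
    ring)
  rw [curveInt_congr fun s hs => hGH s (by
    rw [Finset.mem_singleton]
    rintro rfl
    exact haγ hs)]
  exact hγ.curveInt_eq_zero (isOpen_zetaDomain h) hγΩ
    (fun z hz => winding_eq_zero_of_not_mem_zetaDomain hγ hγΩ hz) hH

/-- Scaling by `2πi` turns every term into a plain curve integral, to be compared under one integral
sign. -/
lemma hasRepresentation_iff {h : ℝ} (hh : 1 < h) {φ Bg : ℂ → ℂ} {γ : ℝ → ℂ} :
    HasRepresentation (zetaDomain h) (zetaSymbol h) φ Bg γ ↔ ∃ p : ℂ → Polynomial ℂ,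
      (∀ s ∈ (finite_zeroSet_inter_closedBall hh (expType φ)).toFinset,
        (p s).degree < (analyticOrderNatAt (zetaSymbol h) s : WithBot ℕ)) ∧
      ∀ t : ℂ, 2 * Real.pi * Complex.I * φ t =
        curveInt γ (fun s => Complex.exp (t * s) * ((zetaSymbol h s)⁻¹ * Bg s)) +
        ∑ s ∈ (finite_zeroSet_inter_closedBall hh (expType φ)).toFinset,
          2 * Real.pi * Complex.I * ((p s).eval t * Complex.exp (t * s)) := by
  have h0 := Complex.two_pi_I_ne_zero
  refine exists_congr fun p => and_congr (by simp) (forall_congr' fun t => ?_)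
  rw [finsum_mem_eq_finite_toFinset_sum _ (finite_zeroSet_inter_closedBall hh (expType φ)),
    ← Finset.mul_sum, pTransform]
  simp only [mul_assoc (Complex.exp _)]
  constructor
  · intro h1
    rw [h1, mul_add, mul_inv_cancel_left₀ h0]
  · intro h1
    refine mul_left_cancel₀ h0 (h1.trans ?_)
    rw [mul_add, mul_inv_cancel_left₀ h0]

lemma hasRepresentation_of_solves {h : ℝ} (hh : 1 < h) {g φ Bg : ℂ → ℂ} {Ug : Set ℂ}
    (hg : IsExpTypeEntire g) (hBg : IsBorelTransform (zetaDomain h) g Bg Ug)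
    (hφ : IsExpTypeEntire φ) {γ : ℝ → ℂ} (hγ : γ ∈ HOne (zetaDomain h) Ug)
    (hγZ : Disjoint (curveTrace γ) (zeroSet (zetaDomain h) (zetaSymbol h)))
    (hγi : ∀ s ∈ zeroSet (zetaDomain h) (zetaSymbol h), s ∈ curveInside γ ↔ ‖s‖ ≤ expType φ)
    (hs : SolvesSymbolEquation (zetaDomain h) (zetaSymbol h) φ g) :
    HasRepresentation (zetaDomain h) (zetaSymbol h) φ Bg γ := by
  have hgφ := expType_le_of_solves hh hs
  obtain ⟨B, U, γ₀, hB, hγ₀, hsol⟩ := hs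
  set f := zetaSymbol h with hfdef
  set Z := zeroSet (zetaDomain h) f with hZ
  have hf : DifferentiableOn ℂ f (zetaDomain h) := differentiableOn_zetaSymbol hh
  obtain ⟨Γ, hΓ, hΓΩ, -, hin, hext, hΓZ, hΓi⟩ := exists_curve_enclosing_zeros hh
    (hB.isCompact_compl.union hBg.isCompact_compl)
    (union_subset (compl_subset_comm.1 hB.compl_subset) (compl_subset_comm.1 hBg.compl_subset))
    (expType_nonneg φ) (lt_add_one _) (union_subset hB.compl_subset_closedBall
      (hBg.compl_subset_closedBall.trans (Metric.closedBall_subset_closedBall hgφ)))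
  have hl := hΓ.isLipschitzLoop
  have hΓU : Γ ∈ HOne (zetaDomain h) U := ⟨hΓ, hΓΩ, subset_union_left.trans hin⟩
  have hΓUg : Γ ∈ HOne (zetaDomain h) Ug := ⟨hΓ, hΓΩ, subset_union_right.trans hin⟩
  have htU := curveTrace_subset_of_mem_HOne hΓU
  have htUg := curveTrace_subset_of_mem_HOne hΓUg
  have hfB : DifferentiableOn ℂ (fun s => f s * B s) (U ∩ zetaDomain h) :=
    (hf.mono inter_subset_right).mul (hB.differentiableOn.mono inter_subset_left)
  have cfB : ContinuousOn (fun s => f s * B s) (curveTrace Γ) :=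
    hfB.continuousOn.mono (subset_inter htU hΓΩ)
  have cBg : ContinuousOn Bg (curveTrace Γ) := hBg.differentiableOn.continuousOn.mono htUg
  have cG : ContinuousOn (fun s => (f s)⁻¹ * Bg s) (curveTrace Γ) :=
    ContinuousOn.mul (fun z hz => (differentiableAt_inv_zetaSymbol hh (hΓΩ hz)
      (disjoint_left.1 hΓZ hz)).continuousAt.continuousWithinAt) cBg
  have h0 : ∀ t : ℂ, curveInt Γ (fun s => Complex.exp (t * s) * (f s * B s - Bg s)) = 0 := by
    intro t
    simp only [mul_sub]
    rw [hl.curveInt_sub (F := fun s => Complex.exp (t * s) * (f s * B s))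
      (G := fun s => Complex.exp (t * s) * Bg s) (continuousOn_exp_mul cfB t)
      (continuousOn_exp_mul cBg t), hBg.curveInt_exp hg hΓ htUg hΓUg.2.2,
      curveInt_eq_of_mem_HOne hh hB.isOpen (empty_subset _) hΓU hγ₀ (by simp)
      (by simp) (by simp) (by simpa using differentiableOn_exp_mul hfB t), ← hsol t, pTransform,
      mul_inv_cancel_left₀ Complex.two_pi_I_ne_zero]
    simp only [mul_assoc, sub_self]
  obtain ⟨W, E, hW, htW, hiW, hE, hEF⟩ := exists_extension_of_curveInt_exp_eq_zero hΓ hext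
    ((hB.isOpen.inter (isOpen_zetaDomain h)).inter hBg.isOpen)
    (subset_inter (subset_inter htU hΓΩ) htUg) (F := fun s => f s * B s - Bg s)
    ((hfB.mono inter_subset_left).sub (hBg.differentiableOn.mono inter_subset_right)) h0
  set S := (finite_zeroSet_inter_closedBall hh (expType φ)).toFinset with hS
  have hmemS : ∀ {a}, a ∈ S ↔ a ∈ Z ∧ ‖a‖ ≤ expType φ := by
    intro a
    rw [hS, Finite.mem_toFinset, mem_inter_iff, mem_closedBall_zero_iff]
  have hT : Z \ S ⊆ zeroSet (zetaDomain h) (zetaSymbol h) := sdiff_subset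
  have hW2 : IsOpen (W ∩ (zetaDomain h \ (Z \ S))) := hW.inter (isOpen_zetaDomain_diff hh hT)
  -- The polynomials are read off from the poles of `E / f` at the zeros inside `Γ`; `E` is the
  -- extension of `f B - Bg`.
  obtain ⟨p, hp, H, hH, hGH⟩ := exists_principalPart_decomposition
    (W := W ∩ (zetaDomain h \ (Z \ S))) S (m := analyticOrderNatAt f)
    (G := fun z => (f z)⁻¹ * E z)
    (fun z hz hzS => (differentiableAt_inv_zetaSymbol hh hz.2.1 fun hzZ =>
      hz.2.2 ⟨hzZ, hzS⟩).mul (hE.differentiableAt (hW.mem_nhds hz.1)))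
    (fun a ha => exists_principalPart_div
      (hE.analyticAt (hW.mem_nhds (hiW ((hΓi a (hmemS.1 ha).1).2 (hmemS.1 ha).2))))
      (hf.analyticAt ((isOpen_zetaDomain h).mem_nhds (hmemS.1 ha).1.1))
      (analyticOrderAt_zetaSymbol_ne_top hh (hmemS.1 ha).1.1))
  have htS : ∀ z ∈ curveTrace Γ, z ∉ S := fun z hz hzS =>
    disjoint_left.1 hΓZ hz (hmemS.1 hzS).1
  have htW2 : curveTrace Γ ⊆ W ∩ (zetaDomain h \ (Z \ S)) := fun z hz =>
    ⟨htW hz, hΓΩ hz, fun h1 => disjoint_left.1 hΓZ hz h1.1⟩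
  have cH : ContinuousOn H (curveTrace Γ) := hH.continuousOn.mono htW2
  have cP : ∀ a ∈ S, ContinuousOn (principalPart (p a) a) (curveTrace Γ) := fun a ha z hz =>
    (differentiableAt_principalPart _ (by rintro rfl; exact htS _ hz ha)).continuousAt.continuousWithinAt
  refine (hasRepresentation_iff hh).2 ⟨p, hp, fun t => ?_⟩
  -- Every zero inside `Γ` belongs to `S`, so `H` has no singularity there.
  have hH0 : curveInt Γ (fun s => Complex.exp (t * s) * H s) = 0 := by
    refine hl.curveInt_eq_zero hW2 htW2 (fun z hz => ?_) (differentiableOn_exp_mul hH t)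
    by_cases hzt : z ∈ curveTrace Γ
    · exact (hz (htW2 hzt)).elim
    by_cases hzΩ : z ∈ zetaDomain h
    · refine hl.winding_eq_zero hzt fun hzi => hz ⟨hiW hzi, hzΩ, fun hzT => hzT.2 ?_⟩
      exact hmemS.2 ⟨hzT.1, (hΓi z hzT.1).1 hzi⟩
    · exact winding_eq_zero_of_not_mem_zetaDomain hl hΓΩ hzΩ
  have hγΓ : curveInt γ (fun s => Complex.exp (t * s) * ((f s)⁻¹ * Bg s)) =
      curveInt Γ (fun s => Complex.exp (t * s) * ((f s)⁻¹ * Bg s)) := by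
    refine curveInt_eq_of_mem_HOne hh hBg.isOpen (T := Z) subset_rfl hγ hΓUg hγZ hΓZ
      (fun s hs => (hγi s hs).trans (hΓi s hs).symm) (differentiableOn_exp_mul (fun z hz => ?_) t)
    exact ((differentiableAt_inv_zetaSymbol hh hz.2.1 hz.2.2).mul
      (hBg.differentiableOn.differentiableAt (hBg.isOpen.mem_nhds hz.1))).differentiableWithinAt
  have hsum : ∑ a ∈ S, 2 * Real.pi * Complex.I * ((p a).eval t * Complex.exp (t * a)) =
      ∑ a ∈ S, curveInt Γ (fun s => Complex.exp (t * s) * principalPart (p a) a s) := by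
    refine Finset.sum_congr rfl fun a ha => ?_
    have ha' := hmemS.1 ha
    rw [hl.curveInt_exp_mul_principalPart _ (fun hat => htS a hat ha),
      hΓ.winding_inside ((hΓi a ha'.1).2 ha'.2)]
  rw [hγΓ, hsum, ← hB.curveInt_exp hφ hΓ htU hΓU.2.2, ← hl.curveInt_finset_sum S fun a ha =>
    continuousOn_exp_mul (cP a ha) t, ← add_zero (curveInt Γ fun s => _ * ((f s)⁻¹ * Bg s)), ← hH0,
    ← hl.curveInt_add, ← hl.curveInt_add]
  · refine curveInt_congr fun s hs => ?_
    have hfs : f s ≠ 0 := fun h1 => disjoint_left.1 hΓZ hs ⟨hΓΩ hs, h1⟩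
    have h1 := hGH s (htS s hs)
    have h2 := hEF s hs
    rw [h2] at h1
    rw [← Finset.mul_sum, ← mul_add, ← mul_add, add_assoc, ← h1]
    field_simp
    ring
  · exact (continuousOn_exp_mul cG t).add (continuousOn_exp_mul cH t)
  · exact continuousOn_finsetSum _ fun a ha => continuousOn_exp_mul (cP a ha) t
  · exact continuousOn_exp_mul cG t
  · exact continuousOn_exp_mul cH t

lemma solves_of_hasRepresentation {h : ℝ} (hh : 1 < h) {g φ Bg : ℂ → ℂ} {Ug : Set ℂ}
    (hg : IsExpTypeEntire g) (hBg : IsBorelTransform (zetaDomain h) g Bg Ug)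
    (hφ : φ ∈ ExpSpace (zetaDomain h)) {γ : ℝ → ℂ} (hγ : γ ∈ HOne (zetaDomain h) Ug)
    (hγZ : Disjoint (curveTrace γ) (zeroSet (zetaDomain h) (zetaSymbol h)))
    (hrep : HasRepresentation (zetaDomain h) (zetaSymbol h) φ Bg γ) :
    SolvesSymbolEquation (zetaDomain h) (zetaSymbol h) φ g := by
  obtain ⟨hφ, B, U, hB⟩ := hφ
  obtain ⟨p, hp, hrep⟩ := (hasRepresentation_iff hh).1 hrep
  set f := zetaSymbol h with hfdef
  set Z := zeroSet (zetaDomain h) f with hZ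
  have hf : DifferentiableOn ℂ f (zetaDomain h) := differentiableOn_zetaSymbol hh
  have hγl := hγ.1.isLipschitzLoop
  obtain ⟨Rγ, -, hRγ⟩ := hγl.exists_closedBall
  -- With this radius `Γ` also encloses every zero that `γ` encloses.
  set R := max Rγ (max (expType φ) (expType g)) with hR
  have hφR : expType φ ≤ R := (le_max_left _ _).trans (le_max_right _ _)
  have hgR : expType g ≤ R := (le_max_right _ _).trans (le_max_right _ _)
  have hγR : ∀ s ∈ curveInside γ, ‖s‖ ≤ R := fun s hs => (mem_closedBall_zero_iff.1
    (IsLipschitzLoop.curveInside_subset_closedBall hRγ hs)).trans (le_max_left _ _)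
  obtain ⟨Γ, hΓ, hΓΩ, -, hin, hext, hΓZ, hΓi⟩ := exists_curve_enclosing_zeros hh
    (hB.isCompact_compl.union hBg.isCompact_compl)
    (union_subset (compl_subset_comm.1 hB.compl_subset) (compl_subset_comm.1 hBg.compl_subset))
    ((expType_nonneg φ).trans hφR) (lt_add_one R) (union_subset
      (hB.compl_subset_closedBall.trans (Metric.closedBall_subset_closedBall hφR))
      (hBg.compl_subset_closedBall.trans (Metric.closedBall_subset_closedBall hgR)))
  have hl := hΓ.isLipschitzLoop
  have hΓU : Γ ∈ HOne (zetaDomain h) U := ⟨hΓ, hΓΩ, subset_union_left.trans hin⟩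
  have hΓUg : Γ ∈ HOne (zetaDomain h) Ug := ⟨hΓ, hΓΩ, subset_union_right.trans hin⟩
  have htU := curveTrace_subset_of_mem_HOne hΓU
  have htUg := curveTrace_subset_of_mem_HOne hΓUg
  -- These zeros obstruct the deformation of `γ` into `Γ`; removing the principal parts of `Bg / f`
  -- there makes it possible.
  have hfin : {s | s ∈ Z ∧ s ∈ curveInside Γ ∧ s ∉ curveInside γ}.Finite :=
    (finite_zeroSet_inter_closedBall hh R).subset fun s hs =>
      ⟨hs.1, mem_closedBall_zero_iff.2 ((hΓi s hs.1).1 hs.2.1)⟩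
  set S := hfin.toFinset with hS
  have hmemS : ∀ {a}, a ∈ S ↔ a ∈ Z ∧ a ∈ curveInside Γ ∧ a ∉ curveInside γ := by
    intro a
    rw [hS, Finite.mem_toFinset, mem_ofPred_eq]
  set P := (finite_zeroSet_inter_closedBall hh (expType φ)).toFinset with hPdef
  have hmemP : ∀ {a}, a ∈ P ↔ a ∈ Z ∧ ‖a‖ ≤ expType φ := by
    intro a
    rw [hPdef, Finite.mem_toFinset, mem_inter_iff, mem_closedBall_zero_iff]
  have hT : Z \ S ⊆ zeroSet (zetaDomain h) (zetaSymbol h) := sdiff_subset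
  have hSU : ∀ a ∈ S, a ∈ Ug := fun a ha => by
    by_contra hcon
    exact (hmemS.1 ha).2.2 (hγ.2.2 hcon)
  obtain ⟨q, hq, H, hH, hGH⟩ := exists_principalPart_decomposition
    (W := Ug ∩ (zetaDomain h \ (Z \ S))) S (m := analyticOrderNatAt f)
    (G := fun z => (f z)⁻¹ * Bg z)
    (fun z hz hzS => (differentiableAt_inv_zetaSymbol hh hz.2.1 fun hzZ =>
      hz.2.2 ⟨hzZ, hzS⟩).mul (hBg.differentiableOn.differentiableAt (hBg.isOpen.mem_nhds hz.1)))
    (fun a ha => exists_principalPart_div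
      (hBg.differentiableOn.analyticAt (hBg.isOpen.mem_nhds (hSU a ha)))
      (hf.analyticAt ((isOpen_zetaDomain h).mem_nhds (hmemS.1 ha).1.1))
      (analyticOrderAt_zetaSymbol_ne_top hh (hmemS.1 ha).1.1))
  have hPZ : ∀ a ∈ P, a ∈ Z := fun a ha => (hmemP.1 ha).1
  have hSZ : ∀ a ∈ S, a ∈ Z := fun a ha => (hmemS.1 ha).1
  have hγt : curveTrace γ ⊆ Ug ∩ (zetaDomain h \ (Z \ S)) := fun z hz =>
    ⟨curveTrace_subset_of_mem_HOne hγ hz, hγ.2.1 hz, fun h1 => disjoint_left.1 hγZ hz h1.1⟩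
  have hΓt : curveTrace Γ ⊆ Ug ∩ (zetaDomain h \ (Z \ S)) := fun z hz =>
    ⟨htUg hz, hΓΩ hz, fun h1 => disjoint_left.1 hΓZ hz h1.1⟩
  have dpp : ∀ {Q : Finset ℂ}, (∀ a ∈ Q, a ∈ Z) → ∀ r : ℂ → Polynomial ℂ, ∀ a ∈ Q, ∀ z ∉ Z,
      DifferentiableAt ℂ (principalPart (r a) a) z := fun hQ r a ha z hz =>
    differentiableAt_principalPart _ (by rintro rfl; exact hz (hQ _ ha))
  have cpp : ∀ {Q : Finset ℂ}, (∀ a ∈ Q, a ∈ Z) → ∀ (r : ℂ → Polynomial ℂ) {c : ℝ → ℂ},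
      Disjoint (curveTrace c) Z → ∀ a ∈ Q, ContinuousOn (principalPart (r a) a) (curveTrace c) :=
    fun hQ r c hc a ha z hz =>
      (dpp hQ r a ha z (disjoint_left.1 hc hz)).continuousAt.continuousWithinAt
  have cH : ContinuousOn H (curveTrace Γ) := hH.continuousOn.mono hΓt
  have cB : ContinuousOn B (curveTrace Γ) := hB.differentiableOn.continuousOn.mono htU
  have cBg : ContinuousOn Bg (curveTrace Γ) := hBg.differentiableOn.continuousOn.mono htUg
  have cf : ContinuousOn f (curveTrace Γ) := hf.continuousOn.mono hΓΩ
  -- the integral over `γ` in terms of the enclosing curve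
  have hγH : ∀ t : ℂ, curveInt γ (fun s => Complex.exp (t * s) * ((f s)⁻¹ * Bg s)) =
      curveInt Γ (fun s => Complex.exp (t * s) * H s) := by
    intro t
    have h1 : curveInt γ (fun s => Complex.exp (t * s) * ((f s)⁻¹ * Bg s)) =
        curveInt γ (fun s => Complex.exp (t * s) * H s +
          ∑ a ∈ S, Complex.exp (t * s) * principalPart (q a) a s) := by
      refine curveInt_congr fun s hs => ?_
      rw [hGH s fun hsS => disjoint_left.1 hγZ hs (hSZ s hsS), mul_add, Finset.mul_sum]
    rw [h1, hγl.curveInt_add (continuousOn_exp_mul (hH.continuousOn.mono hγt) t)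
      (continuousOn_finsetSum _ fun a ha => continuousOn_exp_mul (cpp hSZ q hγZ a ha) t),
      hγl.curveInt_finset_sum S fun a ha => continuousOn_exp_mul (cpp hSZ q hγZ a ha) t,
      Finset.sum_eq_zero, add_zero]
    · refine curveInt_eq_of_mem_HOne hh hBg.isOpen hT hγ hΓUg (hγZ.mono_right sdiff_subset)
        (hΓZ.mono_right sdiff_subset) (fun s hs => ⟨fun h2 => ?_, fun h2 => ?_⟩)
        (differentiableOn_exp_mul hH t)
      · exact (hΓi s hs.1).2 (hγR s h2)
      · by_contra h3
        exact hs.2 (hmemS.2 ⟨hs.1, h2, h3⟩)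
    · intro a ha
      have haγ := disjoint_right.1 hγZ (hSZ a ha)
      rw [hγl.curveInt_exp_mul_principalPart _ haγ, hγl.winding_eq_zero haγ (hmemS.1 ha).2.2,
        zero_mul]
  -- The formula for `φ` says exactly that `F` has vanishing exponential transform on `Γ`.
  let F : ℂ → ℂ := fun s => B s - ((f s)⁻¹ * Bg s - ∑ a ∈ S, principalPart (q a) a s +
    ∑ a ∈ P, principalPart (p a) a s)
  have hFH : ∀ s ∈ curveTrace Γ, F s = B s - (H s + ∑ a ∈ P, principalPart (p a) a s) := by
    intro s hs
    have := hGH s fun hsS => disjoint_left.1 hΓZ hs (hSZ s hsS)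
    simp only [F, this, add_sub_cancel_right]
  have hN : IsOpen ((U ∩ Ug) ∩ (zetaDomain h \ Z)) :=
    (hB.isOpen.inter hBg.isOpen).inter (isOpen_zetaDomain_diff hh subset_rfl)
  have hFd : DifferentiableOn ℂ F ((U ∩ Ug) ∩ (zetaDomain h \ Z)) := fun z hz => by
    refine DifferentiableAt.differentiableWithinAt (DifferentiableAt.sub
      (hB.differentiableOn.differentiableAt (hB.isOpen.mem_nhds hz.1.1)) (DifferentiableAt.add
      (DifferentiableAt.sub (DifferentiableAt.mul (differentiableAt_inv_zetaSymbol hh hz.2.1 hz.2.2)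
      (hBg.differentiableOn.differentiableAt (hBg.isOpen.mem_nhds hz.1.2))) ?_) ?_))
    · exact DifferentiableAt.fun_sum fun a ha => dpp hSZ q a ha z hz.2.2
    · exact DifferentiableAt.fun_sum fun a ha => dpp hPZ p a ha z hz.2.2
  have h0 : ∀ t : ℂ, curveInt Γ (fun s => Complex.exp (t * s) * F s) = 0 := by
    intro t
    have hsum : ∑ a ∈ P, 2 * Real.pi * Complex.I * ((p a).eval t * Complex.exp (t * a)) =
        ∑ a ∈ P, curveInt Γ (fun s => Complex.exp (t * s) * principalPart (p a) a s) := by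
      refine Finset.sum_congr rfl fun a ha => ?_
      rw [hl.curveInt_exp_mul_principalPart _ (disjoint_right.1 hΓZ (hPZ a ha)),
        hΓ.winding_inside ((hΓi a (hPZ a ha)).2 ((hmemP.1 ha).2.trans hφR))]
    have h1 := hrep t
    rw [hγH t, hsum, ← hB.curveInt_exp hφ hΓ htU hΓU.2.2, ← hl.curveInt_finset_sum P fun a ha =>
      continuousOn_exp_mul (cpp hPZ p hΓZ a ha) t, ← hl.curveInt_add (continuousOn_exp_mul cH t)
      (continuousOn_finsetSum _ fun a ha => continuousOn_exp_mul (cpp hPZ p hΓZ a ha) t),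
      ← sub_eq_zero, ← hl.curveInt_sub
      (G := fun s => Complex.exp (t * s) * H s + ∑ a ∈ P, Complex.exp (t * s) *
        principalPart (p a) a s) (continuousOn_exp_mul cB t)
      ((continuousOn_exp_mul cH t).add
      (continuousOn_finsetSum _ fun a ha => continuousOn_exp_mul (cpp hPZ p hΓZ a ha) t))] at h1
    rw [← h1]
    refine curveInt_congr fun s hs => ?_
    rw [hFH s hs, mul_sub, mul_add, Finset.mul_sum]
  obtain ⟨W, E, hW, htW, hiW, hE, hEF⟩ := exists_extension_of_curveInt_exp_eq_zero hΓ hext hN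
    (fun z hz => ⟨⟨htU hz, htUg hz⟩, hΓΩ hz, disjoint_left.1 hΓZ hz⟩) hFd h0
  refine ⟨B, U, Γ, hB, hΓU, fun t => ?_⟩
  have hfE : curveInt Γ (fun s => Complex.exp (t * s) * (f s * E s)) = 0 := by
    refine hl.curveInt_eq_zero (hW.inter (isOpen_zetaDomain h)) (subset_inter htW hΓΩ)
      (fun z hz => ?_) (differentiableOn_exp_mul ((hf.mono inter_subset_right).mul
        (hE.mono inter_subset_left)) t)
    by_cases hzt : z ∈ curveTrace Γ
    · exact (hz ⟨htW hzt, hΓΩ hzt⟩).elim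
    by_cases hzΩ : z ∈ zetaDomain h
    · exact hl.winding_eq_zero hzt fun hzi => hz ⟨hiW hzi, hzΩ⟩
    · exact winding_eq_zero_of_not_mem_zetaDomain hl hΓΩ hzΩ
  have cfpp : ∀ {Q : Finset ℂ}, (∀ a ∈ Q, a ∈ Z) → ∀ r : ℂ → Polynomial ℂ, ∀ a ∈ Q,
      ContinuousOn (fun s => Complex.exp (t * s) * (f s * principalPart (r a) a s))
        (curveTrace Γ) :=
    fun hQ r a ha => continuousOn_exp_mul (cf.mul (cpp hQ r hΓZ a ha)) t
  have hsum0 : ∀ {Q : Finset ℂ}, (∀ a ∈ Q, a ∈ Z) → ∀ r : ℂ → Polynomial ℂ,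
      (∀ a ∈ Q, (r a).degree < (analyticOrderNatAt f a : WithBot ℕ)) →
      curveInt Γ (fun s => ∑ a ∈ Q, Complex.exp (t * s) * (f s * principalPart (r a) a s)) = 0 := by
    intro Q hQ r hr
    rw [hl.curveInt_finset_sum Q (cfpp hQ r)]
    exact Finset.sum_eq_zero fun a ha => curveInt_zetaSymbol_mul_principalPart hh hl hΓΩ
      (hQ a ha).1 (disjoint_right.1 hΓZ (hQ a ha)) (hr a ha) t
  have cfsum : ∀ {Q : Finset ℂ}, (∀ a ∈ Q, a ∈ Z) → ∀ r : ℂ → Polynomial ℂ, ContinuousOn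
      (fun s => ∑ a ∈ Q, Complex.exp (t * s) * (f s * principalPart (r a) a s)) (curveTrace Γ) :=
    fun hQ r => continuousOn_finsetSum _ (cfpp hQ r)
  have hcombine : curveInt Γ (fun s => Complex.exp (t * s) * (f s * B s)) =
      curveInt Γ (fun s => Complex.exp (t * s) * Bg s) := by
    have cfE : ContinuousOn (fun s => f s * E s) (curveTrace Γ) :=
      cf.mul (hE.continuousOn.mono htW)
    -- Multiplying the definition of `F` by `f` gives `f B = Bg + f E` plus terms `f ·
    -- principalPart`; all but `Bg` integrate to zero.
    calc curveInt Γ (fun s => Complex.exp (t * s) * (f s * B s))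
        = curveInt Γ (fun s => (Complex.exp (t * s) * Bg s +
            Complex.exp (t * s) * (f s * E s)) +
            ((∑ a ∈ P, Complex.exp (t * s) * (f s * principalPart (p a) a s)) -
              ∑ a ∈ S, Complex.exp (t * s) * (f s * principalPart (q a) a s))) := by
          refine curveInt_congr fun s hs => ?_
          have hfs : f s ≠ 0 := fun h1 => disjoint_left.1 hΓZ hs ⟨hΓΩ hs, h1⟩
          rw [hEF s hs]
          simp only [F, ← Finset.mul_sum]
          field_simp
          ring
      _ = _ := by
          rw [hl.curveInt_add (F := fun s => Complex.exp (t * s) * Bg s +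
              Complex.exp (t * s) * (f s * E s))
            (G := fun s => (∑ a ∈ P, Complex.exp (t * s) * (f s * principalPart (p a) a s)) -
              ∑ a ∈ S, Complex.exp (t * s) * (f s * principalPart (q a) a s))
            ((continuousOn_exp_mul cBg t).add (continuousOn_exp_mul cfE t))
            ((cfsum hPZ p).sub (cfsum hSZ q)),
            hl.curveInt_add (continuousOn_exp_mul cBg t) (continuousOn_exp_mul cfE t),
            hl.curveInt_sub (cfsum hPZ p) (cfsum hSZ q), hsum0 hPZ p hp, hsum0 hSZ q hq, hfE]
          simp
  rw [pTransform]
  simp only [mul_assoc (Complex.exp _)]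
  rw [hcombine, hBg.curveInt_exp hg hΓ htUg hΓUg.2.2, inv_mul_cancel_left₀ Complex.two_pi_I_ne_zero]

theorem mainTheorem5 (h : ℝ) (hh : 1 < h)
    (g : ℂ → ℂ) (hg : g ∈ ExpSpace (zetaDomain h))
    (Bg : ℂ → ℂ) (Ug : Set ℂ) (hBg : IsBorelTransform (zetaDomain h) g Bg Ug)
    (φ : ℂ → ℂ) (hφ : φ ∈ ExpSpace (zetaDomain h)) :
    -- only finitely many zeros enter the sum
    (zeroSet (zetaDomain h) (zetaSymbol h) ∩ Metric.closedBall 0 (expType φ)).Finite ∧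
    -- for a solution there is a curve that encloses exactly these zeros
    (SolvesSymbolEquation (zetaDomain h) (zetaSymbol h) φ g →
      ∃ γ ∈ HOne (zetaDomain h) Ug,
        Disjoint (curveTrace γ) (zeroSet (zetaDomain h) (zetaSymbol h)) ∧
        ∀ s ∈ zeroSet (zetaDomain h) (zetaSymbol h), s ∈ curveInside γ ↔ ‖s‖ ≤ expType φ) ∧
    -- for every such curve the solutions are the functions given by the formula
    (∀ γ ∈ HOne (zetaDomain h) Ug,
      Disjoint (curveTrace γ) (zeroSet (zetaDomain h) (zetaSymbol h)) →
      (∀ s ∈ zeroSet (zetaDomain h) (zetaSymbol h), s ∈ curveInside γ ↔ ‖s‖ ≤ expType φ) →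
      (SolvesSymbolEquation (zetaDomain h) (zetaSymbol h) φ g ↔
        HasRepresentation (zetaDomain h) (zetaSymbol h) φ Bg γ)) ∧
    -- the formula gives a solution whatever zeros the curve encloses
    (∀ γ ∈ HOne (zetaDomain h) Ug,
      Disjoint (curveTrace γ) (zeroSet (zetaDomain h) (zetaSymbol h)) →
      HasRepresentation (zetaDomain h) (zetaSymbol h) φ Bg γ →
      SolvesSymbolEquation (zetaDomain h) (zetaSymbol h) φ g) := by
  refine ⟨finite_zeroSet_inter_closedBall hh _, fun hs => ?_, fun γ hγ hγZ hγi => ⟨fun hs => ?_,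
    fun hrep => ?_⟩, fun γ hγ hγZ hrep => ?_⟩
  -- The bound `τ_g ≤ τ_φ` puts the singular set of `Bg` in the disc whose zeros are to be enclosed;
  -- the outer radius is immaterial.
  · obtain ⟨Γ, hΓ, hΓΩ, -, hin, -, hΓZ, hΓi⟩ := exists_curve_enclosing_zeros hh
      hBg.isCompact_compl (compl_subset_comm.1 hBg.compl_subset) (expType_nonneg φ) (lt_add_one _)
      (hBg.compl_subset_closedBall.trans
        (Metric.closedBall_subset_closedBall (expType_le_of_solves hh hs)))
    exact ⟨Γ, ⟨hΓ, hΓΩ, hin⟩, hΓZ, hΓi⟩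
  · exact hasRepresentation_of_solves hh hg.1 hBg hφ.1 hγ hγZ hγi hs
  · exact solves_of_hasRepresentation hh hg.1 hBg hφ hγ hγZ hrep
  · exact solves_of_hasRepresentation hh hg.1 hBg hφ hγ hγZ hrep
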